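/- **Syntax.** Fix sets of constants $c$ and of confined constants $f$, each $f$ with an arity. Terms and confined terms are $$A,B,t,u ::= x \mid c \mid s \mid (x:A)\to B \mid x.t \mid t\,u \mid (i:A)\to B \mid i.t \mid t\,l,\qquad l ::= i \mid f(l_1,\dots,l_n),$$ where $s\in\{\mathsf{Type},\mathsf{Kind}\}$, $x$ ranges over regular variables, $i$ over confined variables, and $n$ is the arity of $f$. A signature is a finite list of entries $c:A$, $c:A:=t$ or $f:(i_1:B_1,\dots,i_n:B_n)\to A$ in which no constant is declared twice. A theory $\mathbb T=(\Sigma,\mathcal R,\mathcal E)$ is a signature with a set $\mathcal R$ of rewrite rules $c\,\vec a\longrightarrow u$ (with $\mathrm{fv}(u)\subseteq\mathrm{fv}(c\,\vec a)$) and a set $\mathcal E$ of equations between confined terms. **Reduction and conversion.** $\longrightarrow_\beta$ and $\longrightarrow_{\beta_c}$ are the closures by context of $(x.t)u\longrightarrow t[x\mapsto u]$ and $(i.t)l\longrightarrow t[i\mapsto l]$; $\longrightarrow_{\mathcal R}$ is the closure of $\mathcal R$ by context and substitution; $\longrightarrow_\delta$ is the closure by context of $c\longrightarrow t$ for the definitions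 $c:A:=t$ in $\Sigma$; and $\longrightarrow$ is the union of these four relations. $\simeq$ is the reflexive-symmetric-transitive closure of $\mathcal E$ by context and substitution, and $\equiv$ is the reflexive-symmetric-transitive closure of $\longrightarrow\cup\simeq$, both on terms whose constants are declared in $\Sigma$. **Typing.** A context $\Gamma$ is a finite list of entries $x:A$ and $i:A$. The judgments $\Gamma\vdash$, $\Gamma\vdash t:A$ and $\Gamma\vdash l:A$ are generated by the following rules. * $\cdot\vdash$; if $\Gamma\vdash A:\mathsf{Type}$ then $\Gamma,x:A\vdash$ and $\Gamma,i:A\vdash$. * If $\Gamma\vdash$, then $\Gamma\vdash\mathsf{Type}:\mathsf{Kind}$; $\Gamma\vdash x:A$ for $x:A\in\Gamma$; $\Gamma\vdash i:A$ for $i:A\in\Gamma$; $\Gamma\vdash c:A$ for $c:A\in\Sigma$ or $c:A:=u\in\Sigma$; and, for $f:(i_1:B_1,\dots,i_n:B_n)\to A\in\Sigma$, if $\Gamma\vdash l_k:B_k[i_1\mapsto l_1,\dots,i_{k-1}\mapsto l_{k-1}]$ for all $k$, then $\Gamma\vdash f(\vec l):A[\vec i\mapsto\vec l]$. * If $\Gamma\vdash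 t:A$, $\Gamma\vdash B:s$ and $A\equiv B$, then $\Gamma\vdash t:B$. If $\Gamma\vdash l:A$, $\Gamma\vdash B:\mathsf{Type}$ and $A\equiv B$, then $\Gamma\vdash l:B$. * If $\Gamma\vdash A:\mathsf{Type}$ and $\Gamma,x:A\vdash B:s$, then $\Gamma\vdash(x:A)\to B:s$; if moreover $\Gamma,x:A\vdash t:B$, then $\Gamma\vdash x.t:(x:A)\to B$. The same two rules hold with a confined variable $i$ in place of $x$. * If $\Gamma\vdash t:(x:A)\to B$ and $\Gamma\vdash u:A$, then $\Gamma\vdash t\,u:B[x\mapsto u]$. If $\Gamma\vdash t:(i:A)\to B$ and $\Gamma\vdash l:A$, then $\Gamma\vdash t\,l:B[i\mapsto l]$. A signature entry $c:A$, $c:A:=t$ or $f:\Delta\to A$ is valid in a theory if in that theory, respectively, $\vdash A:s$ for some sort $s$, $\vdash t:A$, or $\Delta\vdash A:\mathsf{Type}$. A theory is well-formed if every entry of its signature is valid in the theory formed by the prefix of the signature preceding the entry and those rules and equations that contain only constants of this prefix. **The theory $\mathbb{UPP}$.** Its signature consists, in this order, of $\mathsf{Lvl}:\mathsf{Type}$,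 the confined constants $0:()\to\mathsf{Lvl}$, $\mathsf S:(i:\mathsf{Lvl})\to\mathsf{Lvl}$ and $\sqcup:(i:\mathsf{Lvl},i':\mathsf{Lvl})\to\mathsf{Lvl}$, and \begin{align*} &\mathsf{Ty}:(l:\mathsf{Lvl})\to\mathsf{Type},\qquad \mathsf{Tm}:(l:\mathsf{Lvl})\to\mathsf{Ty}\,l\to\mathsf{Type},\qquad \mathsf U:(l:\mathsf{Lvl})\to\mathsf{Ty}\,(\mathsf S\,l),\\ &\Pi:(l\,l':\mathsf{Lvl})\to(A:\mathsf{Ty}\,l)\to(B:\mathsf{Tm}\,l\,A\to\mathsf{Ty}\,l')\to\mathsf{Ty}\,(l\sqcup l'),\\ &\lambda:(l\,l':\mathsf{Lvl})\to(A:\mathsf{Ty}\,l)\to(B:\mathsf{Tm}\,l\,A\to\mathsf{Ty}\,l')\to((x:\mathsf{Tm}\,l\,A)\to\mathsf{Tm}\,l'\,(B\,x))\to\mathsf{Tm}\,(l\sqcup l')\,(\Pi\,l\,l'\,A\,B),\\ &@:(l\,l':\mathsf{Lvl})\to(A:\mathsf{Ty}\,l)\to(B:\mathsf{Tm}\,l\,A\to\mathsf{Ty}\,l')\to(t:\mathsf{Tm}\,(l\sqcup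 l')\,(\Pi\,l\,l'\,A\,B))\to(u:\mathsf{Tm}\,l\,A)\to\mathsf{Tm}\,l'\,(B\,u), \end{align*} where $l,l'$ are confined variables. Its rewrite rules are $$\mathsf{Tm}\,l'\,(\mathsf U\,l)\longrightarrow\mathsf{Ty}\,l,\qquad @\,l\,l'\,A\,B\,(\lambda\,l''\,l'''\,A'\,B'\,t)\,u\longrightarrow t\,u,$$ and its equations are \begin{align*} i_1\sqcup(i_2\sqcup i_3)&\simeq(i_1\sqcup i_2)\sqcup i_3, & \mathsf S(i_1\sqcup i_2)&\simeq\mathsf S\,i_1\sqcup\mathsf S\,i_2, & i\sqcup0&\simeq i,\\ i_1\sqcup i_2&\simeq i_2\sqcup i_1, & i\sqcup\mathsf S\,i&\simeq\mathsf S\,i, & i\sqcup i&\simeq i. \end{align*} A local signature well-formed in $\mathbb{UPP}$ is a signature $\Phi$ without confined constants such that the theory $\mathbb{UPP},\Phi$, obtained by appending $\Phi$ to the signature of $\mathbb{UPP}$ and keeping its rules and equations, is well-formed. **Proposition (Subject Reduction).** Let $\Phi$ be a local signature well-formed in $\mathbb{UPP}$. In the theory $\mathbb{UPP},\Phi$,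 if $\Gamma\vdash t:A$ and $t\longrightarrow t'$ (one step of $\beta$, $\beta_c$, $\delta$ or the rewrite rules), then $\Gamma\vdash t':A$. -/

import Mathlib

/-! # Dedukti with confinement and rewriting modulo

Terms are represented with de Bruijn indices.  Regular and confined variables live in two separate
index spaces: a regular index counts only the enclosing regular binders, a confined index counts
only the enclosing confined binders. -/

namespace Dedukti

universe u v

/-- Confined terms `l ::= i | f(l₁, …, lₙ)` with `n` the arity of `f`. -/
inductive CTerm {F : Type v} (ar : F → ℕ) : Type v
  | ivar (n : ℕ) : CTerm ar
  | fn (f : F) (ls : Fin (ar f) → CTerm ar) : CTerm ar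

/-- The sorts `Type` and `Kind`. -/
inductive Srt : Type
  | type
  | kind

/-- Terms `x | c | s | (x : A) → B | x. t | t u | (i : A) → B | i. t | t l`.  The second argument of
`pi`, and the argument of `abs`, bind a regular variable; the second argument of `piC`, and the
argument of `absC`, bind a confined variable. -/
inductive Term (C : Type u) {F : Type v} (ar : F → ℕ) : Type (max u v)
  | var (n : ℕ) : Term C ar
  | const (c : C) : Term C ar
  | sort (s : Srt) : Term C ar
  | pi (A B : Term C ar) : Term C ar
  | abs (t : Term C ar) : Term C ar
  | app (t u : Term C ar) : Term C ar
  | piC (A B : Term C ar) : Term C ar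
  | absC (t : Term C ar) : Term C ar
  | appC (t : Term C ar) (l : CTerm ar) : Term C ar

variable {C : Type u} {F : Type v} {ar : F → ℕ}

/-! ## Renaming and substitution -/

/-- The extension of a sequence `f` by a new value at index `0`. -/
def scons {α : Type*} (a : α) (f : ℕ → α) : ℕ → α
  | 0 => a
  | n + 1 => f n

/-- The lifting of a renaming under one binder. -/
def liftRen (ρ : ℕ → ℕ) : ℕ → ℕ := scons 0 (fun n => ρ n + 1)

/-- Renaming of the variables of a confined term. -/
def CTerm.rename (ξ : ℕ → ℕ) : CTerm ar → CTerm ar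
  | .ivar n => .ivar (ξ n)
  | .fn f ls => .fn f (fun k => (ls k).rename ξ)

/-- Substitution in a confined term. -/
def CTerm.subst (τ : ℕ → CTerm ar) : CTerm ar → CTerm ar
  | .ivar n => τ n
  | .fn f ls => .fn f (fun k => (ls k).subst τ)

/-- Renaming of the regular variables by `ρ` and of the confined variables by `ξ`. -/
def Term.rename : (ℕ → ℕ) → (ℕ → ℕ) → Term C ar → Term C ar
  | ρ, _, .var n => .var (ρ n)
  | _, _, .const c => .const c
  | _, _, .sort s => .sort s
  | ρ, ξ, .pi A B => .pi (A.rename ρ ξ) (B.rename (liftRen ρ) ξ)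
  | ρ, ξ, .abs t => .abs (t.rename (liftRen ρ) ξ)
  | ρ, ξ, .app t u => .app (t.rename ρ ξ) (u.rename ρ ξ)
  | ρ, ξ, .piC A B => .piC (A.rename ρ ξ) (B.rename ρ (liftRen ξ))
  | ρ, ξ, .absC t => .absC (t.rename ρ (liftRen ξ))
  | ρ, ξ, .appC t l => .appC (t.rename ρ ξ) (l.rename ξ)

/-- Weakening of a term by one regular variable. -/
def Term.shift (t : Term C ar) : Term C ar := t.rename Nat.succ id

/-- Weakening of a term by one confined variable. -/
def Term.shiftC (t : Term C ar) : Term C ar := t.rename id Nat.succ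

/-- Weakening of a confined term by one confined variable. -/
def CTerm.shiftC (l : CTerm ar) : CTerm ar := l.rename Nat.succ

/-- Simultaneous capture-avoiding substitution: regular variables are replaced by terms through
`σ`, confined variables by confined terms through `τ`. -/
def Term.subst : (ℕ → Term C ar) → (ℕ → CTerm ar) → Term C ar → Term C ar
  | σ, _, .var n => σ n
  | _, _, .const c => .const c
  | _, _, .sort s => .sort s
  | σ, τ, .pi A B => .pi (A.subst σ τ) (B.subst (scons (.var 0) (fun n => (σ n).shift)) τ)
  | σ, τ, .abs t => .abs (t.subst (scons (.var 0) (fun n => (σ n).shift)) τ)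
  | σ, τ, .app t u => .app (t.subst σ τ) (u.subst σ τ)
  | σ, τ, .piC A B =>
      .piC (A.subst σ τ)
        (B.subst (fun n => (σ n).shiftC) (scons (.ivar 0) (fun n => (τ n).shiftC)))
  | σ, τ, .absC t =>
      .absC (t.subst (fun n => (σ n).shiftC) (scons (.ivar 0) (fun n => (τ n).shiftC)))
  | σ, τ, .appC t l => .appC (t.subst σ τ) (l.subst τ)

/-- `t[x ↦ u]` for the last regular variable `x`. -/
def Term.inst (t u : Term C ar) : Term C ar := t.subst (scons u Term.var) CTerm.ivar

/-- `t[i ↦ l]` for the last confined variable `i`. -/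
def Term.instC (t : Term C ar) (l : CTerm ar) : Term C ar := t.subst Term.var (scons l CTerm.ivar)

/-- For `ls = (l₁, …, lₙ)` and `k ≤ n`, the substitution `i₁ ↦ l₁, …, iₖ ↦ lₖ` for the last `k`
confined variables `i₁, …, iₖ`; the most recent one, `iₖ`, has index `0`. -/
def prefixSubst {n : ℕ} (ls : Fin n → CTerm ar) (k : ℕ) (hk : k ≤ n) (m : ℕ) : CTerm ar :=
  if h : m < k then ls ⟨k - 1 - m, by omega⟩ else .ivar (m - k)

/-! ## Free variables and constants of a term -/

/-- The confined variable `n` occurs in the confined term. -/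
def CTerm.HasVar : ℕ → CTerm ar → Prop
  | n, .ivar m => m = n
  | n, .fn _ ls => ∃ k, (ls k).HasVar n

/-- The regular variable `n` occurs free in the term. -/
def Term.HasVar : ℕ → Term C ar → Prop
  | n, .var m => m = n
  | _, .const _ => False
  | _, .sort _ => False
  | n, .pi A B => A.HasVar n ∨ B.HasVar (n + 1)
  | n, .abs t => t.HasVar (n + 1)
  | n, .app t u => t.HasVar n ∨ u.HasVar n
  | n, .piC A B => A.HasVar n ∨ B.HasVar n
  | n, .absC t => t.HasVar n
  | n, .appC t _ => t.HasVar n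

/-- The confined variable `n` occurs free in the term. -/
def Term.HasVarC : ℕ → Term C ar → Prop
  | _, .var _ => False
  | _, .const _ => False
  | _, .sort _ => False
  | n, .pi A B => A.HasVarC n ∨ B.HasVarC n
  | n, .abs t => t.HasVarC n
  | n, .app t u => t.HasVarC n ∨ u.HasVarC n
  | n, .piC A B => A.HasVarC n ∨ B.HasVarC (n + 1)
  | n, .absC t => t.HasVarC (n + 1)
  | n, .appC t l => t.HasVarC n ∨ l.HasVar n

/-- All confined constants of the confined term satisfy `Q`. -/
def CTerm.Over (Q : F → Prop) : CTerm ar → Prop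
  | .ivar _ => True
  | .fn f ls => Q f ∧ ∀ k, (ls k).Over Q

/-- All constants of the term satisfy `P` and all its confined constants satisfy `Q`. -/
def Term.Over (P : C → Prop) (Q : F → Prop) : Term C ar → Prop
  | .var _ => True
  | .const c => P c
  | .sort _ => True
  | .pi A B => A.Over P Q ∧ B.Over P Q
  | .abs t => t.Over P Q
  | .app t u => t.Over P Q ∧ u.Over P Q
  | .piC A B => A.Over P Q ∧ B.Over P Q
  | .absC t => t.Over P Q
  | .appC t l => t.Over P Q ∧ l.Over Q

/-! ## Signatures, rewrite rules, theories -/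

/-- Signature entries: `c : A`, `c : A := t` and `f : (i₁ : B₁, …, iₙ : Bₙ) → A` with `n` the arity
of `f`.  In a confined entry `Δ k` may use the confined variables `0, …, k - 1` and `A` may use the
confined variables `0, …, n - 1`, the index `0` being the most recent one. -/
inductive Decl (C : Type u) {F : Type v} (ar : F → ℕ) : Type (max u v)
  | const (c : C) (A : Term C ar) : Decl C ar
  | defn (c : C) (A t : Term C ar) : Decl C ar
  | conf (f : F) (Δ : Fin (ar f) → Term C ar) (A : Term C ar) : Decl C ar

/-- The constant or confined constant that an entry declares. -/
def Decl.name : Decl C ar → C ⊕ F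
  | .const c _ => .inl c
  | .defn c _ _ => .inl c
  | .conf f _ _ => .inr f

/-- The entry declares a confined constant. -/
def Decl.IsConfined : Decl C ar → Prop
  | .const _ _ => False
  | .defn _ _ _ => False
  | .conf _ _ _ => True

/-- The application of a term to a list of terms and confined terms. -/
def Term.spine (t : Term C ar) (as : List (Term C ar ⊕ CTerm ar)) : Term C ar :=
  as.foldl (fun s a => Sum.elim s.app s.appC a) t

/-- Rewrite rules `c a₁ … aₖ ⟶ u` with `fv(u) ⊆ fv(c a₁ … aₖ)`.  The free variables of the two
sides, regular and confined, are the variables of the rule. -/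
structure Rule (C : Type u) {F : Type v} (ar : F → ℕ) where
  head : C
  args : List (Term C ar ⊕ CTerm ar)
  rhs : Term C ar
  fv_rhs : ∀ n, rhs.HasVar n → ((Term.const head).spine args).HasVar n
  fvC_rhs : ∀ n, rhs.HasVarC n → ((Term.const head).spine args).HasVarC n

/-- The left-hand side of a rewrite rule. -/
def Rule.lhs (r : Rule C ar) : Term C ar := (Term.const r.head).spine r.args

/-- A theory: a signature (in order of declaration), a set of rewrite rules and a set of equations
between confined terms. -/
structure Theory (C : Type u) {F : Type v} (ar : F → ℕ) where
  sig : List (Decl C ar)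
  rules : Set (Rule C ar)
  eqs : Set (CTerm ar × CTerm ar)

/-- The constant `c` is declared in the signature. -/
def DeclaredIn (S : List (Decl C ar)) (c : C) : Prop := Sum.inl c ∈ S.map Decl.name

/-- The confined constant `f` is declared in the signature. -/
def DeclaredInC (S : List (Decl C ar)) (f : F) : Prop := Sum.inr f ∈ S.map Decl.name

/-- The term contains only constants and confined constants declared in the signature. -/
def Term.OverSig (S : List (Decl C ar)) (t : Term C ar) : Prop :=
  t.Over (DeclaredIn S) (DeclaredInC S)

/-! ## Reduction and conversion -/

/-- Closure by context of a relation on confined terms. -/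
inductive CompatC (Q : CTerm ar → CTerm ar → Prop) : CTerm ar → CTerm ar → Prop
  | root {l l'} : Q l l' → CompatC Q l l'
  | fn {f : F} {ls : Fin (ar f) → CTerm ar} {k : Fin (ar f)} {l'} :
      CompatC Q (ls k) l' → CompatC Q (.fn f ls) (.fn f (Function.update ls k l'))

/-- Closure by context, on terms, of a relation `R` on terms and a relation `Q` on confined
terms. -/
inductive Compat (R : Term C ar → Term C ar → Prop) (Q : CTerm ar → CTerm ar → Prop) :
    Term C ar → Term C ar → Prop
  | root {t t'} : R t t' → Compat R Q t t'
  | piL {A A' B} : Compat R Q A A' → Compat R Q (.pi A B) (.pi A' B)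
  | piR {A B B'} : Compat R Q B B' → Compat R Q (.pi A B) (.pi A B')
  | abs {t t'} : Compat R Q t t' → Compat R Q (.abs t) (.abs t')
  | appL {t t' u} : Compat R Q t t' → Compat R Q (.app t u) (.app t' u)
  | appR {t u u'} : Compat R Q u u' → Compat R Q (.app t u) (.app t u')
  | piCL {A A' B} : Compat R Q A A' → Compat R Q (.piC A B) (.piC A' B)
  | piCR {A B B'} : Compat R Q B B' → Compat R Q (.piC A B) (.piC A B')
  | absC {t t'} : Compat R Q t t' → Compat R Q (.absC t) (.absC t')
  | appCL {t t' l} : Compat R Q t t' → Compat R Q (.appC t l) (.appC t' l)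
  | appCR {t l l'} : CompatC Q l l' → Compat R Q (.appC t l) (.appC t l')

/-- Closure by context of a relation on terms. -/
def CtxClosure (R : Term C ar → Term C ar → Prop) : Term C ar → Term C ar → Prop :=
  Compat R (fun _ _ => False)

/-- `(x. t) u ⟶ t[x ↦ u]` at the root. -/
inductive BetaRoot : Term C ar → Term C ar → Prop
  | mk (t u : Term C ar) : BetaRoot (.app (.abs t) u) (t.inst u)

/-- `(i. t) l ⟶ t[i ↦ l]` at the root. -/
inductive BetaCRoot : Term C ar → Term C ar → Prop
  | mk (t : Term C ar) (l : CTerm ar) : BetaCRoot (.appC (.absC t) l) (t.instC l)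

namespace Theory

variable (T : Theory C ar)

/-- `c ⟶ t` at the root, for a definition `c : A := t` of the signature. -/
inductive DeltaRoot : Term C ar → Term C ar → Prop
  | mk {c : C} {A t : Term C ar} : Decl.defn c A t ∈ T.sig → DeltaRoot (.const c) t

/-- Instances of the rewrite rules at the root. -/
inductive RuleRoot : Term C ar → Term C ar → Prop
  | mk {r : Rule C ar} (hr : r ∈ T.rules) (σ : ℕ → Term C ar) (τ : ℕ → CTerm ar) :
      RuleRoot (r.lhs.subst σ τ) (r.rhs.subst σ τ)

/-- Instances of the equations at the root. -/
inductive EqRoot : CTerm ar → CTerm ar → Prop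
  | mk {e : CTerm ar × CTerm ar} (he : e ∈ T.eqs) (τ : ℕ → CTerm ar) :
      EqRoot (e.1.subst τ) (e.2.subst τ)

/-- One-step reduction: the union of the relations for `β`, `β_c`, the rewrite rules and `δ`. -/
def Step (t t' : Term C ar) : Prop :=
  CtxClosure BetaRoot t t' ∨ CtxClosure BetaCRoot t t' ∨ CtxClosure T.RuleRoot t t' ∨
    CtxClosure T.DeltaRoot t t'

/-- The relation `≃` on the terms of the theory: the reflexive-symmetric-transitive closure by
context and substitution of the equations. -/
def Sim : Term C ar → Term C ar → Prop :=
  Relation.EqvGen fun t u =>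
    t.OverSig T.sig ∧ u.OverSig T.sig ∧ Compat (fun _ _ => False) T.EqRoot t u

/-- Conversion `≡` on the terms of the theory: the reflexive-symmetric-transitive closure of the
union of one-step reduction and `≃`. -/
def Conv : Term C ar → Term C ar → Prop :=
  Relation.EqvGen fun t u =>
    t.OverSig T.sig ∧ u.OverSig T.sig ∧ (T.Step t u ∨ T.Sim t u)

end Theory

/-! ## Contexts and typing -/

/-- Context entries `x : A` and `i : A`. -/
inductive Entry (C : Type u) {F : Type v} (ar : F → ℕ) : Type (max u v)
  | reg (A : Term C ar) : Entry C ar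
  | conf (A : Term C ar) : Entry C ar

/-- Contexts; the head of the list is the most recent entry. -/
abbrev Ctx (C : Type u) {F : Type v} (ar : F → ℕ) : Type (max u v) := List (Entry C ar)

/-- `x : A ∈ Γ` for the regular variable `x` of index `n`; the type is weakened to `Γ`. -/
inductive LookupVar : Ctx C ar → ℕ → Term C ar → Prop
  | here {Γ A} : LookupVar (.reg A :: Γ) 0 A.shift
  | thereReg {Γ n A B} : LookupVar Γ n A → LookupVar (.reg B :: Γ) (n + 1) A.shift
  | thereConf {Γ n A B} : LookupVar Γ n A → LookupVar (.conf B :: Γ) n A.shiftC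

/-- `i : A ∈ Γ` for the confined variable `i` of index `n`; the type is weakened to `Γ`. -/
inductive LookupVarC : Ctx C ar → ℕ → Term C ar → Prop
  | here {Γ A} : LookupVarC (.conf A :: Γ) 0 A.shiftC
  | thereReg {Γ n A B} : LookupVarC Γ n A → LookupVarC (.reg B :: Γ) n A.shift
  | thereConf {Γ n A B} : LookupVarC Γ n A → LookupVarC (.conf B :: Γ) (n + 1) A.shiftC

mutual

/-- `Γ ⊢` -/
inductive WfCtx (T : Theory C ar) : Ctx C ar → Prop
  | empty : WfCtx T []
  | ext {Γ A} : HasType T Γ A (.sort .type) → WfCtx T (.reg A :: Γ)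
  | extC {Γ A} : HasType T Γ A (.sort .type) → WfCtx T (.conf A :: Γ)

/-- `Γ ⊢ t : A` -/
inductive HasType (T : Theory C ar) : Ctx C ar → Term C ar → Term C ar → Prop
  | sort {Γ} : WfCtx T Γ → HasType T Γ (.sort .type) (.sort .kind)
  | var {Γ n A} : WfCtx T Γ → LookupVar Γ n A → HasType T Γ (.var n) A
  | const {Γ c A} : WfCtx T Γ → Decl.const c A ∈ T.sig → HasType T Γ (.const c) A
  | defn {Γ c A u} : WfCtx T Γ → Decl.defn c A u ∈ T.sig → HasType T Γ (.const c) A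
  | conv {Γ t A B s} : HasType T Γ t A → HasType T Γ B (.sort s) → T.Conv A B → HasType T Γ t B
  | pi {Γ A B s} : HasType T Γ A (.sort .type) → HasType T (.reg A :: Γ) B (.sort s) →
      HasType T Γ (.pi A B) (.sort s)
  | piC {Γ A B s} : HasType T Γ A (.sort .type) → HasType T (.conf A :: Γ) B (.sort s) →
      HasType T Γ (.piC A B) (.sort s)
  | abs {Γ A B t s} : HasType T Γ A (.sort .type) → HasType T (.reg A :: Γ) B (.sort s) →
      HasType T (.reg A :: Γ) t B → HasType T Γ (.abs t) (.pi A B)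
  | absC {Γ A B t s} : HasType T Γ A (.sort .type) → HasType T (.conf A :: Γ) B (.sort s) →
      HasType T (.conf A :: Γ) t B → HasType T Γ (.absC t) (.piC A B)
  | app {Γ A B t u} : HasType T Γ t (.pi A B) → HasType T Γ u A →
      HasType T Γ (.app t u) (B.inst u)
  | appC {Γ A B t l} : HasType T Γ t (.piC A B) → HasTypeC T Γ l A →
      HasType T Γ (.appC t l) (B.instC l)

/-- `Γ ⊢ l : A` -/
inductive HasTypeC (T : Theory C ar) : Ctx C ar → CTerm ar → Term C ar → Prop
  | ivar {Γ n A} : WfCtx T Γ → LookupVarC Γ n A → HasTypeC T Γ (.ivar n) A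
  | fn {Γ f Δ A} {ls : Fin (ar f) → CTerm ar} : WfCtx T Γ → Decl.conf f Δ A ∈ T.sig →
      (∀ k : Fin (ar f), HasTypeC T Γ (ls k) ((Δ k).subst .var (prefixSubst ls k k.isLt.le))) →
      HasTypeC T Γ (.fn f ls) (A.subst .var (prefixSubst ls (ar f) le_rfl))
  | conv {Γ l A B} : HasTypeC T Γ l A → HasType T Γ B (.sort .type) → T.Conv A B →
      HasTypeC T Γ l B

end

/-! ## Well-formed theories -/

/-- Validity of a signature entry in a theory. -/
def Decl.Valid (T : Theory C ar) : Decl C ar → Prop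
  | .const _ A => ∃ s, HasType T [] A (.sort s)
  | .defn _ A t => HasType T [] t A
  | .conf _ Δ A => HasType T ((List.ofFn Δ).reverse.map Entry.conf) A (.sort .type)

/-- The theory with signature `S` whose rules and equations are those of `T` that contain only
constants declared in `S`. -/
def Theory.restrict (T : Theory C ar) (S : List (Decl C ar)) : Theory C ar where
  sig := S
  rules := {r ∈ T.rules | r.lhs.OverSig S ∧ r.rhs.OverSig S}
  eqs := {e ∈ T.eqs | e.1.Over (DeclaredInC S) ∧ e.2.Over (DeclaredInC S)}

/-- A theory is well-formed when no constant is declared twice and every signature entry is valid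
in the restriction of the theory to the prefix of the signature that precedes the entry. -/
def Theory.WellFormed (T : Theory C ar) : Prop :=
  (T.sig.map Decl.name).Nodup ∧
    ∀ S d S', T.sig = S ++ d :: S' → d.Valid (T.restrict S)

/-- The extension of the signature of a theory. -/
def Theory.extend (T : Theory C ar) (Φ : List (Decl C ar)) : Theory C ar where
  sig := T.sig ++ Φ
  rules := T.rules
  eqs := T.eqs

/-- `Φ` is a well-formed local signature in `T`: it declares no confined constant, and the
extension of `T` by `Φ` is well-formed. -/
def Theory.IsLocalSignature (T : Theory C ar) (Φ : List (Decl C ar)) : Prop :=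
  (∀ d ∈ Φ, ¬ d.IsConfined) ∧ (T.extend Φ).WellFormed

end Dedukti

/-! # The theory UPP -/

namespace UPP

open Dedukti

universe w

/-- The constants of UPP, together with names for the constants of a local signature. -/
inductive Const (L : Type w) : Type w
  | Lvl
  | Ty
  | Tm
  | U
  | Pi
  | Lam
  | App
  | loc (c : L)

/-- The confined constants of UPP. -/
inductive Conf : Type
  | zero
  | succ
  | max

/-- The arities of the confined constants. -/
def arity : Conf → ℕ
  | .zero => 0
  | .succ => 1
  | .max => 2

/-- Levels. -/
abbrev Level : Type := CTerm arity

/-- Terms of UPP with local constants named by `L`. -/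
abbrev Trm (L : Type w) : Type w := Term (Const L) arity

/-- The level `0`. -/
def zero : Level := .fn .zero ![]

/-- The level `S l`. -/
def succ (l : Level) : Level := .fn .succ ![l]

/-- The level `l ⊔ l'`. -/
def max (l l' : Level) : Level := .fn .max ![l, l']

/-- The confined variable of index `n`. -/
def i (n : ℕ) : Level := .ivar n

variable {L : Type w}

/-- The regular variable of index `n`. -/
def x (n : ℕ) : Trm L := .var n

/-- The sort `Type`. -/
def type : Trm L := .sort .type

/-- `Lvl` -/
def Lvl : Trm L := .const .Lvl

/-- `Ty l` -/
def Ty (l : Level) : Trm L := .appC (.const .Ty) l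

/-- `Tm l A` -/
def Tm (l : Level) (A : Trm L) : Trm L := .app (.appC (.const .Tm) l) A

/-- `U l` -/
def U (l : Level) : Trm L := .appC (.const .U) l

/-- `Π l l' A B` -/
def Pi (l l' : Level) (A B : Trm L) : Trm L :=
  .app (.app (.appC (.appC (.const .Pi) l) l') A) B

/-- `(l : Lvl) → Type` -/
def tyType : Trm L := .piC Lvl type

/-- `(l : Lvl) → Ty l → Type` -/
def tmType : Trm L := .piC Lvl (.pi (Ty (i 0)) type)

/-- `(l : Lvl) → Ty (S l)` -/
def uType : Trm L := .piC Lvl (Ty (succ (i 0)))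

/-- `(l l' : Lvl) → (A : Ty l) → (B : Tm l A → Ty l') → Ty (l ⊔ l')` -/
def piType : Trm L :=
  .piC Lvl <| .piC Lvl <| .pi (Ty (i 1)) <| .pi (.pi (Tm (i 1) (x 0)) (Ty (i 0))) <|
    Ty (max (i 1) (i 0))

/-- `(l l' : Lvl) → (A : Ty l) → (B : Tm l A → Ty l') → ((x : Tm l A) → Tm l' (B x)) →
Tm (l ⊔ l') (Π l l' A B)` -/
def lamType : Trm L :=
  .piC Lvl <| .piC Lvl <| .pi (Ty (i 1)) <| .pi (.pi (Tm (i 1) (x 0)) (Ty (i 0))) <|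
    .pi (.pi (Tm (i 1) (x 1)) (Tm (i 0) (.app (x 1) (x 0)))) <|
      Tm (max (i 1) (i 0)) (Pi (i 1) (i 0) (x 2) (x 1))

/-- `(l l' : Lvl) → (A : Ty l) → (B : Tm l A → Ty l') → (t : Tm (l ⊔ l') (Π l l' A B)) →
(u : Tm l A) → Tm l' (B u)` -/
def appType : Trm L :=
  .piC Lvl <| .piC Lvl <| .pi (Ty (i 1)) <| .pi (.pi (Tm (i 1) (x 0)) (Ty (i 0))) <|
    .pi (Tm (max (i 1) (i 0)) (Pi (i 1) (i 0) (x 1) (x 0))) <| .pi (Tm (i 1) (x 2)) <|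
      Tm (i 0) (.app (x 2) (x 0))

/-- The signature of UPP. -/
def sig (L : Type w) : List (Decl (Const L) arity) :=
  [.const .Lvl type,
   .conf .zero (fun _ => Lvl) Lvl,
   .conf .succ (fun _ => Lvl) Lvl,
   .conf .max (fun _ => Lvl) Lvl,
   .const .Ty tyType,
   .const .Tm tmType,
   .const .U uType,
   .const .Pi piType,
   .const .Lam lamType,
   .const .App appType]

/-- `Tm l' (U l) ⟶ Ty l`, where `l, l'` are the confined variables `0, 1`. -/
def ruleU (L : Type w) : Rule (Const L) arity where
  head := .Tm
  args := [.inr (i 1), .inl (U (i 0))]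
  rhs := Ty (i 0)
  fv_rhs := by simp [Ty, Term.HasVar]
  fvC_rhs := by simp [Ty, U, i, Term.spine, Term.HasVarC, CTerm.HasVar]

/-- `@ l l' A B (λ l'' l''' A' B' t) u ⟶ t u`, where `l, l', l'', l'''` are the confined variables
`0, …, 3` and `A, B, A', B', t, u` are the regular variables `0, …, 5`. -/
def ruleBeta (L : Type w) : Rule (Const L) arity where
  head := .App
  args := [.inr (i 0), .inr (i 1), .inl (x 0), .inl (x 1),
    .inl ((Term.const .Lam).spine
      [.inr (i 2), .inr (i 3), .inl (x 2), .inl (x 3), .inl (x 4)]),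
    .inl (x 5)]
  rhs := .app (x 4) (x 5)
  fv_rhs := by
    simp only [x, Term.spine, Term.HasVar, List.foldl, Sum.elim_inl, Sum.elim_inr]
    tauto
  fvC_rhs := by simp [x, Term.HasVarC]

/-- The equations on levels. -/
def eqs : Set (Level × Level) :=
  {(max (i 1) (max (i 2) (i 3)), max (max (i 1) (i 2)) (i 3)),
   (max (i 1) (i 2), max (i 2) (i 1)),
   (succ (max (i 1) (i 2)), max (succ (i 1)) (succ (i 2))),
   (max (i 0) (succ (i 0)), succ (i 0)),
   (max (i 0) zero, i 0),
   (max (i 0) (i 0), i 0)}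

/-- The theory UPP; `L` supplies the names that a local signature may use. -/
def theory (L : Type w) : Theory (Const L) arity where
  sig := sig L
  rules := {ruleU L, ruleBeta L}
  eqs := eqs

end UPP

/-! Parallel reduction modulo the equations on levels has the diamond property, because every term
has a complete development: the left-hand sides of the rules of UPP are linear and contain levels
only as variables, so that a conversion of levels neither creates nor destroys a redex, and the
subterms of the redexes can be developed independently.  Hence convertible products have convertible
components, which gives preservation of types by `β` and `β_c`, and makes the types computed from
the signature principal for `Tm`, `U`, `λ` and `@`.  For `@ l l' A B (λ k k' A' B' t) u ⟶ t u`,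
comparing the principal type of the abstraction with the type expected by `@` gives `l ≃ k`,
`l' ≃ k'`, `A ≡ A'` and `B ≡ B'`, hence `t u` has the type of the left-hand side. -/

namespace Dedukti

variable {C F : Type*} {ar : F → ℕ}

/-! ## Substitution calculus -/

theorem forall_scons {α : Type*} {p : α → Prop} {a : α} {f : ℕ → α} (ha : p a)
    (hf : ∀ n, p (f n)) : ∀ n, p (scons a f n)
  | 0 => ha
  | n + 1 => hf n

theorem forall₂_scons {α : Type*} {r : α → α → Prop} {a b : α} {f g : ℕ → α} (hab : r a b)
    (hfg : ∀ n, r (f n) (g n)) : ∀ n, r (scons a f n) (scons b g n)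
  | 0 => hab
  | n + 1 => hfg n

/-- The lifting of a substitution of regular variables under a regular binder. -/
def up (σ : ℕ → Term C ar) : ℕ → Term C ar := scons (.var 0) (fun n => (σ n).shift)

/-- The weakening of a substitution of regular variables under a confined binder. -/
def upShiftC (σ : ℕ → Term C ar) : ℕ → Term C ar := fun n => (σ n).shiftC

/-- The lifting of a substitution of confined variables under a confined binder. -/
def upC (τ : ℕ → CTerm ar) : ℕ → CTerm ar := scons (.ivar 0) (fun n => (τ n).shiftC)

theorem up_var (ρ : ℕ → ℕ) :
    up (fun n => (.var (ρ n) : Term C ar)) = fun n => .var (liftRen ρ n) := by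
  funext n; cases n <;> rfl

theorem upC_ivar (ξ : ℕ → ℕ) :
    upC (fun n => (.ivar (ξ n) : CTerm ar)) = fun n => .ivar (liftRen ξ n) := by
  funext n; cases n <;> rfl

theorem upShiftC_var (ρ : ℕ → ℕ) :
    upShiftC (fun n => (.var (ρ n) : Term C ar)) = fun n => .var (ρ n) := rfl

@[simp]
theorem up_var_id : up (Term.var : ℕ → Term C ar) = .var := by
  funext n; cases n <;> rfl

@[simp]
theorem upC_ivar_id : upC (CTerm.ivar : ℕ → CTerm ar) = .ivar := by
  funext n; cases n <;> rfl

@[simp]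
theorem upShiftC_var_id : upShiftC (Term.var : ℕ → Term C ar) = .var := rfl

theorem up_comp_liftRen (σ : ℕ → Term C ar) (ρ : ℕ → ℕ) :
    (fun n => up σ (liftRen ρ n)) = up (fun n => σ (ρ n)) := by
  funext n; cases n <;> rfl

theorem upC_comp_liftRen (τ : ℕ → CTerm ar) (ξ : ℕ → ℕ) :
    (fun n => upC τ (liftRen ξ n)) = upC (fun n => τ (ξ n)) := by
  funext n; cases n <;> rfl

theorem upShiftC_comp (σ : ℕ → Term C ar) (ρ : ℕ → ℕ) :
    (fun n => upShiftC σ (ρ n)) = upShiftC (fun n => σ (ρ n)) := rfl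

namespace CTerm

theorem rename_eq_subst (l : CTerm ar) (ξ : ℕ → ℕ) :
    l.rename ξ = l.subst (fun n => .ivar (ξ n)) := by
  induction l with
  | ivar n => rfl
  | fn f ls ih => simp only [rename, subst, ih]

theorem subst_subst (l : CTerm ar) (τ τ' : ℕ → CTerm ar) :
    (l.subst τ).subst τ' = l.subst (fun n => (τ n).subst τ') := by
  induction l with
  | ivar n => rfl
  | fn f ls ih => simp only [subst, ih]

@[simp]
theorem subst_id (l : CTerm ar) : l.subst .ivar = l := by
  induction l with
  | ivar n => rfl
  | fn f ls ih => simp only [subst, ih]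

theorem rename_id (l : CTerm ar) : l.rename id = l :=
  (l.rename_eq_subst id).trans l.subst_id

theorem subst_rename (l : CTerm ar) (ξ : ℕ → ℕ) (τ : ℕ → CTerm ar) :
    (l.rename ξ).subst τ = l.subst (fun n => τ (ξ n)) := by
  rw [rename_eq_subst, subst_subst]; rfl

theorem rename_subst (l : CTerm ar) (ξ : ℕ → ℕ) (τ : ℕ → CTerm ar) :
    (l.subst τ).rename ξ = l.subst (fun n => (τ n).rename ξ) := by
  simp only [rename_eq_subst, subst_subst]

theorem rename_upC (τ : ℕ → CTerm ar) (ξ : ℕ → ℕ) :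
    (fun n => (upC τ n).rename (liftRen ξ)) = upC (fun n => (τ n).rename ξ) := by
  funext n
  cases n
  · rfl
  · simp only [upC, scons, shiftC, rename_eq_subst, subst_subst]; rfl

theorem subst_upC (τ τ' : ℕ → CTerm ar) :
    (fun n => (upC τ n).subst (upC τ')) = upC (fun n => (τ n).subst τ') := by
  funext n
  cases n
  · rfl
  · simp only [upC, scons, shiftC, rename_subst, subst_rename]

end CTerm

namespace Term

section
variable (σ : ℕ → Term C ar) (τ : ℕ → CTerm ar)

@[simp] theorem subst_var (n : ℕ) : (Term.var n).subst σ τ = σ n := rfl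
@[simp] theorem subst_const (c : C) : (Term.const c : Term C ar).subst σ τ = .const c := rfl
@[simp] theorem subst_sort (s : Srt) : (Term.sort s : Term C ar).subst σ τ = .sort s := rfl
@[simp] theorem subst_pi (A B : Term C ar) :
    (Term.pi A B).subst σ τ = .pi (A.subst σ τ) (B.subst (up σ) τ) := rfl
@[simp] theorem subst_abs (t : Term C ar) : (Term.abs t).subst σ τ = .abs (t.subst (up σ) τ) := rfl
@[simp] theorem subst_app (t u : Term C ar) :
    (Term.app t u).subst σ τ = .app (t.subst σ τ) (u.subst σ τ) := rfl
@[simp] theorem subst_piC (A B : Term C ar) :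
    (Term.piC A B).subst σ τ = .piC (A.subst σ τ) (B.subst (upShiftC σ) (upC τ)) := rfl
@[simp] theorem subst_absC (t : Term C ar) :
    (Term.absC t).subst σ τ = .absC (t.subst (upShiftC σ) (upC τ)) := rfl
@[simp] theorem subst_appC (t : Term C ar) (l : CTerm ar) :
    (Term.appC t l).subst σ τ = .appC (t.subst σ τ) (l.subst τ) := rfl

end

theorem rename_eq_subst (t : Term C ar) (ρ ξ : ℕ → ℕ) :
    t.rename ρ ξ = t.subst (fun n => .var (ρ n)) (fun n => .ivar (ξ n)) := by
  induction t generalizing ρ ξ with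
  | appC t l ih => simp only [rename, subst_appC, ih, CTerm.rename_eq_subst]
  | _ => simp_all [rename, up_var, upC_ivar, upShiftC_var]

theorem subst_rename (t : Term C ar) (ρ ξ : ℕ → ℕ) (σ : ℕ → Term C ar) (τ : ℕ → CTerm ar) :
    (t.rename ρ ξ).subst σ τ = t.subst (fun n => σ (ρ n)) (fun n => τ (ξ n)) := by
  induction t generalizing ρ ξ σ τ with
  | appC t l ih => simp only [rename, subst_appC, ih, CTerm.subst_rename]
  | _ => simp_all [rename, up_comp_liftRen, upC_comp_liftRen, upShiftC_comp]

theorem rename_rename (t : Term C ar) (ρ ξ ρ' ξ' : ℕ → ℕ) :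
    (t.rename ρ ξ).rename ρ' ξ' = t.rename (fun n => ρ' (ρ n)) (fun n => ξ' (ξ n)) := by
  rw [rename_eq_subst _ ρ', subst_rename, rename_eq_subst]

theorem shift_rename (t : Term C ar) (ρ ξ : ℕ → ℕ) :
    t.shift.rename (liftRen ρ) ξ = (t.rename ρ ξ).shift := by
  simp only [shift, rename_rename]; rfl

theorem shiftC_rename (t : Term C ar) (ρ ξ : ℕ → ℕ) :
    t.shiftC.rename ρ (liftRen ξ) = (t.rename ρ ξ).shiftC := by
  simp only [shiftC, rename_rename]; rfl

theorem rename_up (σ : ℕ → Term C ar) (ρ ξ : ℕ → ℕ) :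
    (fun n => (up σ n).rename (liftRen ρ) ξ) = up (fun n => (σ n).rename ρ ξ) := by
  funext n
  cases n
  · rfl
  · exact shift_rename _ ρ ξ

theorem rename_upShiftC (σ : ℕ → Term C ar) (ρ ξ : ℕ → ℕ) :
    (fun n => (upShiftC σ n).rename ρ (liftRen ξ)) = upShiftC (fun n => (σ n).rename ρ ξ) :=
  funext fun _ => shiftC_rename _ ρ ξ

theorem rename_subst (t : Term C ar) (ρ ξ : ℕ → ℕ) (σ : ℕ → Term C ar) (τ : ℕ → CTerm ar) :
    (t.subst σ τ).rename ρ ξ =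
      t.subst (fun n => (σ n).rename ρ ξ) (fun n => (τ n).rename ξ) := by
  induction t generalizing ρ ξ σ τ with
  | appC t l ih => simp only [rename, subst_appC, ih, CTerm.rename_subst]
  | _ => simp_all [rename, rename_up, rename_upShiftC, CTerm.rename_upC]

theorem shift_subst (t : Term C ar) (σ : ℕ → Term C ar) (τ : ℕ → CTerm ar) :
    (t.subst σ τ).shift = t.shift.subst (up σ) τ := by
  simp only [shift, rename_subst, subst_rename, CTerm.rename_id]; rfl

theorem shiftC_subst (t : Term C ar) (σ : ℕ → Term C ar) (τ : ℕ → CTerm ar) :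
    (t.subst σ τ).shiftC = t.shiftC.subst (upShiftC σ) (upC τ) := by
  simp only [shiftC, rename_subst, subst_rename]; rfl

theorem subst_up (σ σ' : ℕ → Term C ar) (τ : ℕ → CTerm ar) :
    (fun n => (up σ n).subst (up σ') τ) = up (fun n => (σ n).subst σ' τ) := by
  funext n
  cases n
  · rfl
  · exact (shift_subst _ _ _).symm

theorem subst_upShiftC (σ σ' : ℕ → Term C ar) (τ : ℕ → CTerm ar) :
    (fun n => (upShiftC σ n).subst (upShiftC σ') (upC τ)) =
      upShiftC (fun n => (σ n).subst σ' τ) :=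
  funext fun _ => (shiftC_subst _ _ _).symm

theorem subst_subst (t : Term C ar) (σ σ' : ℕ → Term C ar) (τ τ' : ℕ → CTerm ar) :
    (t.subst σ τ).subst σ' τ' =
      t.subst (fun n => (σ n).subst σ' τ') (fun n => (τ n).subst τ') := by
  induction t generalizing σ σ' τ τ' with
  | appC t l ih => simp only [subst_appC, ih, CTerm.subst_subst]
  | _ => simp_all [subst_up, subst_upShiftC, CTerm.subst_upC]

@[simp]
theorem subst_id (t : Term C ar) : t.subst .var .ivar = t := by
  induction t <;> simp_all

theorem shift_eq_subst (t : Term C ar) :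
    t.shift = t.subst (fun n => .var (n + 1)) .ivar := rename_eq_subst t _ _

theorem shiftC_eq_subst (t : Term C ar) :
    t.shiftC = t.subst .var (fun n => .ivar (n + 1)) := rename_eq_subst t _ _

theorem shift_subst_scons (t u : Term C ar) (σ : ℕ → Term C ar) (τ : ℕ → CTerm ar) :
    t.shift.subst (scons u σ) τ = t.subst σ τ := subst_rename t _ _ _ _

theorem shiftC_subst_scons (t : Term C ar) (l : CTerm ar) (σ : ℕ → Term C ar)
    (τ : ℕ → CTerm ar) : t.shiftC.subst σ (scons l τ) = t.subst σ τ := subst_rename t _ _ _ _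

@[simp]
theorem shift_inst (t u : Term C ar) : t.shift.inst u = t :=
  (shift_subst_scons _ _ _ _).trans t.subst_id

@[simp]
theorem shiftC_instC (t : Term C ar) (l : CTerm ar) : t.shiftC.instC l = t :=
  (shiftC_subst_scons _ _ _ _).trans t.subst_id

theorem inst_subst (t u : Term C ar) (σ : ℕ → Term C ar) (τ : ℕ → CTerm ar) :
    (t.inst u).subst σ τ = (t.subst (up σ) τ).inst (u.subst σ τ) := by
  simp only [inst, subst_subst, CTerm.subst_id]
  congr 1
  funext n
  cases n
  · rfl
  · exact (shift_inst _ _).symm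

theorem instC_subst (t : Term C ar) (l : CTerm ar) (σ : ℕ → Term C ar) (τ : ℕ → CTerm ar) :
    (t.instC l).subst σ τ = (t.subst (upShiftC σ) (upC τ)).instC (l.subst τ) := by
  simp only [instC, subst_subst]
  congr 1
  · funext n; exact (shiftC_instC _ _).symm
  · funext n
    cases n
    · rfl
    · simp only [upC, scons, CTerm.shiftC, CTerm.subst_rename]
      exact (CTerm.subst_id _).symm

end Term

/-! ## Constants of a term -/

theorem CTerm.Over.mono {Q Q' : F → Prop} {l : CTerm ar} (h : l.Over Q) (hQ : ∀ f, Q f → Q' f) :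
    l.Over Q' := by
  induction l with
  | ivar n => trivial
  | fn f ls ih => exact ⟨hQ _ h.1, fun k => ih k (h.2 k)⟩

theorem Term.Over.mono {P P' : C → Prop} {Q Q' : F → Prop} {t : Term C ar} (h : t.Over P Q)
    (hP : ∀ c, P c → P' c) (hQ : ∀ f, Q f → Q' f) : t.Over P' Q' := by
  induction t with
  | appC t l ih => exact ⟨ih h.1, h.2.mono hQ⟩
  | _ => simp_all [Over]

theorem CTerm.Over.subst {Q : F → Prop} {l : CTerm ar} (h : l.Over Q) {τ : ℕ → CTerm ar}
    (hτ : ∀ n, (τ n).Over Q) : (l.subst τ).Over Q := by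
  induction l with
  | ivar n => exact hτ n
  | fn f ls ih => exact ⟨h.1, fun k => ih k (h.2 k)⟩

theorem CTerm.Over.rename {Q : F → Prop} {l : CTerm ar} (h : l.Over Q) (ξ : ℕ → ℕ) :
    (l.rename ξ).Over Q := by
  rw [CTerm.rename_eq_subst]
  exact h.subst fun _ => trivial

theorem Term.Over.rename {P : C → Prop} {Q : F → Prop} {t : Term C ar} (h : t.Over P Q)
    (ρ ξ : ℕ → ℕ) : (t.rename ρ ξ).Over P Q := by
  induction t generalizing ρ ξ with
  | appC t l ih => exact ⟨ih h.1 _ _, h.2.rename ξ⟩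
  | _ => simp_all [Term.rename, Over]

/-- The substitution `σ, τ` introduces only constants satisfying `P` and confined constants
satisfying `Q`. -/
structure SubstOver (P : C → Prop) (Q : F → Prop) (σ : ℕ → Term C ar) (τ : ℕ → CTerm ar) :
    Prop where
  reg : ∀ n, (σ n).Over P Q
  conf : ∀ n, (τ n).Over Q

namespace SubstOver

variable {P : C → Prop} {Q : F → Prop} {σ : ℕ → Term C ar} {τ : ℕ → CTerm ar}

theorem of_renaming (ρ ξ : ℕ → ℕ) :
    SubstOver P Q (fun n => (.var (ρ n) : Term C ar)) (fun n => .ivar (ξ n)) :=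
  ⟨fun _ => trivial, fun _ => trivial⟩

theorem up (h : SubstOver P Q σ τ) : SubstOver P Q (up σ) τ :=
  ⟨forall_scons trivial fun n => (h.reg n).rename _ _, h.conf⟩

theorem upC (h : SubstOver P Q σ τ) : SubstOver P Q (upShiftC σ) (upC τ) :=
  ⟨fun n => (h.reg n).rename _ _, forall_scons trivial fun n => (h.conf n).rename _⟩

theorem inst {u : Term C ar} (hu : u.Over P Q) : SubstOver P Q (scons u .var) .ivar :=
  ⟨forall_scons hu fun _ => trivial, fun _ => trivial⟩

theorem sconsC (h : SubstOver P Q σ τ) {l : CTerm ar} (hl : l.Over Q) :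
    SubstOver P Q σ (scons l τ) :=
  ⟨h.reg, forall_scons hl h.conf⟩

end SubstOver

theorem Term.Over.subst {P : C → Prop} {Q : F → Prop} {t : Term C ar} (h : t.Over P Q)
    {σ : ℕ → Term C ar} {τ : ℕ → CTerm ar} (hs : SubstOver P Q σ τ) : (t.subst σ τ).Over P Q := by
  induction t generalizing σ τ with
  | var n => exact hs.reg n
  | const c => exact h
  | sort s => trivial
  | pi A B ihA ihB => exact ⟨ihA h.1 hs, ihB h.2 hs.up⟩
  | abs t ih => exact ih h hs.up
  | app t u iht ihu => exact ⟨iht h.1 hs, ihu h.2 hs⟩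
  | piC A B ihA ihB => exact ⟨ihA h.1 hs, ihB h.2 hs.upC⟩
  | absC t ih => exact ih h hs.upC
  | appC t l ih => exact ⟨ih h.1 hs, h.2.subst hs.conf⟩

/-! ## Reduction and conversion -/

theorem CompatC.exists_root {Q : CTerm ar → CTerm ar → Prop} {l l' : CTerm ar}
    (h : CompatC Q l l') :
    ∃ m m', Q m m' ∧ ∀ {Q' : CTerm ar → CTerm ar → Prop}, Q' m m' → CompatC Q' l l' := by
  induction h with
  | root h => exact ⟨_, _, h, .root⟩
  | fn _ ih =>
    obtain ⟨m, m', h, hplug⟩ := ih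
    exact ⟨m, m', h, fun h' => .fn (hplug h')⟩

theorem CompatC.subst {Q : CTerm ar → CTerm ar → Prop} {τ : ℕ → CTerm ar}
    (hQ : ∀ l l', Q l l' → Q (l.subst τ) (l'.subst τ)) {l l' : CTerm ar} (h : CompatC Q l l') :
    CompatC Q (l.subst τ) (l'.subst τ) := by
  induction h with
  | root h => exact .root (hQ _ _ h)
  | @fn f ls k l' _ ih =>
    have hupdate : (fun j => (Function.update ls k l' j).subst τ) =
        Function.update (fun j => (ls j).subst τ) k (l'.subst τ) :=
      funext fun j => Function.apply_update (fun _ (l : CTerm ar) => l.subst τ) ls k l' j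
    simp only [CTerm.subst, hupdate]
    exact .fn ih

/-- `t` and `t'` arise by plugging a pair related by `R` or by `Q` into one context; the context is
encoded by quantifying over all relations that contain the plugged pair. -/
def PluggedRoot (R : Term C ar → Term C ar → Prop) (Q : CTerm ar → CTerm ar → Prop)
    (t t' : Term C ar) : Prop :=
  (∃ u u', R u u' ∧ ∀ {R' Q'}, R' u u' → Compat R' Q' t t') ∨
    ∃ l l', Q l l' ∧ ∀ {R' Q'}, Q' l l' → Compat R' Q' t t'

theorem PluggedRoot.map {R : Term C ar → Term C ar → Prop} {Q : CTerm ar → CTerm ar → Prop}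
    {t t' s s' : Term C ar} (h : PluggedRoot R Q t t')
    (hs : ∀ {R' Q'}, Compat R' Q' t t' → Compat R' Q' s s') : PluggedRoot R Q s s' :=
  h.imp (fun ⟨u, u', hu, hplug⟩ => ⟨u, u', hu, fun h => hs (hplug h)⟩)
    (fun ⟨l, l', hl, hplug⟩ => ⟨l, l', hl, fun h => hs (hplug h)⟩)

theorem Compat.pluggedRoot {R : Term C ar → Term C ar → Prop} {Q : CTerm ar → CTerm ar → Prop}
    {t t' : Term C ar} (h : Compat R Q t t') : PluggedRoot R Q t t' := by
  induction h with
  | root h => exact .inl ⟨_, _, h, .root⟩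
  | piL _ ih => exact ih.map .piL
  | piR _ ih => exact ih.map .piR
  | abs _ ih => exact ih.map .abs
  | appL _ ih => exact ih.map .appL
  | appR _ ih => exact ih.map .appR
  | piCL _ ih => exact ih.map .piCL
  | piCR _ ih => exact ih.map .piCR
  | absC _ ih => exact ih.map .absC
  | appCL _ ih => exact ih.map .appCL
  | appCR h =>
    obtain ⟨l, l', h, hplug⟩ := h.exists_root
    exact .inr ⟨l, l', h, fun h' => .appCR (hplug h')⟩

theorem Compat.mono {R R' : Term C ar → Term C ar → Prop} {Q Q' : CTerm ar → CTerm ar → Prop}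
    (hR : ∀ t t', R t t' → R' t t') (hQ : ∀ l l', Q l l' → Q' l l') {t t' : Term C ar}
    (h : Compat R Q t t') : Compat R' Q' t t' := by
  rcases h.pluggedRoot with ⟨_, _, h, hplug⟩ | ⟨_, _, h, hplug⟩
  exacts [hplug (hR _ _ h), hplug (hQ _ _ h)]

theorem Compat.subst {R : Term C ar → Term C ar → Prop} {Q : CTerm ar → CTerm ar → Prop}
    (hR : ∀ t t' σ τ, R t t' → R (t.subst σ τ) (t'.subst σ τ))
    (hQ : ∀ l l' τ, Q l l' → Q (l.subst τ) (l'.subst τ)) {t t' : Term C ar}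
    (h : Compat R Q t t') (σ : ℕ → Term C ar) (τ : ℕ → CTerm ar) :
    Compat R Q (t.subst σ τ) (t'.subst σ τ) := by
  induction h generalizing σ τ with
  | root h => exact .root (hR _ _ _ _ h)
  | piL _ ih => exact .piL (ih _ _)
  | piR _ ih => exact .piR (ih _ _)
  | abs _ ih => exact .abs (ih _ _)
  | appL _ ih => exact .appL (ih _ _)
  | appR _ ih => exact .appR (ih _ _)
  | piCL _ ih => exact .piCL (ih _ _)
  | piCR _ ih => exact .piCR (ih _ _)
  | absC _ ih => exact .absC (ih _ _)
  | appCL _ ih => exact .appCL (ih _ _)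
  | appCR h => exact .appCR (h.subst fun _ _ h => hQ _ _ _ h)

/-- Every variable of the term is a confined variable of index less than `k`, expressed through the
action of substitutions. -/
def Term.ScopedBelow (k : ℕ) (t : Term C ar) : Prop :=
  ∀ (σ σ' : ℕ → Term C ar) (τ τ' : ℕ → CTerm ar), (∀ n < k, τ n = τ' n) →
    t.subst σ τ = t.subst σ' τ'

theorem Term.ScopedBelow.subst_eq {t : Term C ar} (h : t.ScopedBelow 0) (σ : ℕ → Term C ar)
    (τ : ℕ → CTerm ar) : t.subst σ τ = t :=
  (h _ _ _ _ fun _ hn => absurd hn (Nat.not_lt_zero _)).trans t.subst_id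

namespace Theory

variable {T : Theory C ar}

/-- The constant `c` is declared with type `A`, with or without a definition. -/
def Declares (T : Theory C ar) (c : C) (A : Term C ar) : Prop :=
  Decl.const c A ∈ T.sig ∨ ∃ t, Decl.defn c A t ∈ T.sig

/-- The types and the definitions of constants are closed, and the type of a confined constant
depends only on its arguments.  This is what makes the theory stable under substitution. -/
structure Scoped (T : Theory C ar) : Prop where
  type {c A} : T.Declares c A → A.ScopedBelow 0
  body {c A t} : Decl.defn c A t ∈ T.sig → t.ScopedBelow 0
  argType {f Δ A} : Decl.conf f Δ A ∈ T.sig → ∀ k, (Δ k).ScopedBelow k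
  resultType {f Δ A} : Decl.conf f Δ A ∈ T.sig → A.ScopedBelow (ar f)

/-- The union of the root relations of one-step reduction. -/
inductive RootStep (T : Theory C ar) : Term C ar → Term C ar → Prop
  | beta (t u : Term C ar) : RootStep T (.app (.abs t) u) (t.inst u)
  | betaC (t : Term C ar) (l : CTerm ar) : RootStep T (.appC (.absC t) l) (t.instC l)
  | rule {t t' : Term C ar} : T.RuleRoot t t' → RootStep T t t'
  | delta {c : C} {A t : Term C ar} : Decl.defn c A t ∈ T.sig → RootStep T (.const c) t

theorem step_iff {t t' : Term C ar} : T.Step t t' ↔ CtxClosure T.RootStep t t' := by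
  constructor
  · rintro (h | h | h | h)
    · exact h.mono (fun _ _ ⟨t, u⟩ => .beta t u) fun _ _ => id
    · exact h.mono (fun _ _ ⟨t, l⟩ => .betaC t l) fun _ _ => id
    · exact h.mono (fun _ _ => .rule) fun _ _ => id
    · exact h.mono (fun _ _ ⟨h⟩ => .delta h) fun _ _ => id
  · intro h
    rcases h.pluggedRoot with ⟨_, _, h, hplug⟩ | ⟨_, _, h, _⟩
    · cases h with
      | beta t u => exact .inl (hplug ⟨t, u⟩)
      | betaC t l => exact .inr (.inl (hplug ⟨t, l⟩))
      | rule h => exact .inr (.inr (.inl (hplug h)))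
      | delta h => exact .inr (.inr (.inr (hplug ⟨h⟩)))
    · exact h.elim

theorem EqRoot.subst {l l' : CTerm ar} (h : T.EqRoot l l') (τ : ℕ → CTerm ar) :
    T.EqRoot (l.subst τ) (l'.subst τ) := by
  obtain ⟨he, τ'⟩ := h
  simp only [CTerm.subst_subst]
  exact .mk he _

theorem RootStep.subst (hT : T.Scoped) {t t' : Term C ar} (h : T.RootStep t t')
    (σ : ℕ → Term C ar) (τ : ℕ → CTerm ar) : T.RootStep (t.subst σ τ) (t'.subst σ τ) := by
  cases h with
  | beta t u => rw [Term.inst_subst]; exact .beta _ _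
  | betaC t l => rw [Term.instC_subst]; exact .betaC _ _
  | rule h =>
    obtain ⟨hr, σ', τ'⟩ := h
    simp only [Term.subst_subst]
    exact .rule (.mk hr _ _)
  | delta h => rw [(hT.body h).subst_eq]; exact .delta h

/-- One step of reduction or of an equation between terms of the theory. -/
def ConvStep (T : Theory C ar) (t u : Term C ar) : Prop :=
  t.OverSig T.sig ∧ u.OverSig T.sig ∧ Compat T.RootStep T.EqRoot t u

theorem conv_iff {t u : Term C ar} : T.Conv t u ↔ Relation.EqvGen T.ConvStep t u := by
  constructor
  · intro h
    induction h with
    | refl t => exact .refl t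
    | symm _ _ _ ih => exact ih.symm
    | trans _ _ _ _ _ ih ih' => exact ih.trans _ _ _ ih'
    | rel t u h =>
      obtain ⟨ht, hu, h | h⟩ := h
      · exact .rel _ _ ⟨ht, hu, (step_iff.1 h).mono (fun _ _ => id) fun _ _ => False.elim⟩
      · exact h.mono fun _ _ ⟨ht, hu, h⟩ =>
          ⟨ht, hu, h.mono (fun _ _ => False.elim) fun _ _ => id⟩
  · intro h
    refine h.mono fun t u ⟨ht, hu, h⟩ => ⟨ht, hu, ?_⟩
    rcases h.pluggedRoot with ⟨_, _, h, hplug⟩ | ⟨_, _, h, hplug⟩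
    · exact .inl (step_iff.2 (hplug h))
    · exact .inr (.rel _ _ ⟨ht, hu, hplug h⟩)

/-- Convertibility of confined terms modulo the equations of the theory. -/
def ConvC (T : Theory C ar) : CTerm ar → CTerm ar → Prop :=
  Relation.EqvGen (CompatC T.EqRoot)

namespace ConvC

variable {l l' m : CTerm ar}

theorem refl (l : CTerm ar) : T.ConvC l l := Relation.EqvGen.refl l

theorem symm (h : T.ConvC l l') : T.ConvC l' l := Relation.EqvGen.symm _ _ h

theorem trans (h : T.ConvC l l') (h' : T.ConvC l' m) : T.ConvC l m :=
  Relation.EqvGen.trans _ _ _ h h'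

theorem map {g : CTerm ar → CTerm ar}
    (hg : ∀ l l', CompatC T.EqRoot l l' → CompatC T.EqRoot (g l) (g l')) (h : T.ConvC l l') :
    T.ConvC (g l) (g l') := by
  induction h with
  | refl l => exact .refl _
  | rel l l' h => exact .rel _ _ (hg _ _ h)
  | symm _ _ _ ih => exact ih.symm
  | trans _ _ _ _ _ ih ih' => exact ih.trans ih'

theorem update {f : F} (ls : Fin (ar f) → CTerm ar) (k : Fin (ar f)) (h : T.ConvC l l') :
    T.ConvC (.fn f (Function.update ls k l)) (.fn f (Function.update ls k l')) := by
  refine h.map (g := fun l => .fn f (Function.update ls k l)) fun l l' h => ?_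
  simpa using CompatC.fn (ls := Function.update ls k l) (k := k) (l' := l') (by simpa using h)

theorem fn {f : F} {ls ls' : Fin (ar f) → CTerm ar} (h : ∀ k, T.ConvC (ls k) (ls' k)) :
    T.ConvC (.fn f ls) (.fn f ls') := by
  have hpiecewise (s : Finset (Fin (ar f))) : T.ConvC (.fn f ls) (.fn f (s.piecewise ls' ls)) := by
    induction s using Finset.induction_on with
    | empty => simpa using refl _
    | insert k s hk ih =>
      have hstep := update (s.piecewise ls' ls) k (h k)
      rw [← Finset.piecewise_insert, Function.update_eq_self_iff.2] at hstep
      · exact ih.trans hstep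
      · simp [hk]
  simpa using hpiecewise Finset.univ

theorem subst (h : T.ConvC l l') {τ τ' : ℕ → CTerm ar} (hτ : ∀ n, T.ConvC (τ n) (τ' n)) :
    T.ConvC (l.subst τ) (l'.subst τ') := by
  have hcongr (l : CTerm ar) : T.ConvC (l.subst τ) (l.subst τ') := by
    induction l with
    | ivar n => exact hτ n
    | fn f ls ih => exact fn ih
  exact (h.map (g := CTerm.subst τ) fun _ _ h => h.subst fun _ _ h => h.subst τ).trans (hcongr l')

end ConvC

namespace Conv

theorem refl (t : Term C ar) : T.Conv t t := Relation.EqvGen.refl t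

theorem symm {t u : Term C ar} (h : T.Conv t u) : T.Conv u t := Relation.EqvGen.symm _ _ h

theorem trans {t u w : Term C ar} (h : T.Conv t u) (h' : T.Conv u w) : T.Conv t w :=
  Relation.EqvGen.trans _ _ _ h h'

theorem of_step {t u : Term C ar} (ht : t.OverSig T.sig) (hu : u.OverSig T.sig)
    (h : CtxClosure T.RootStep t u) : T.Conv t u :=
  .rel _ _ ⟨ht, hu, .inl (step_iff.2 h)⟩

theorem map (f : Term C ar → Term C ar) (hf : ∀ t, t.OverSig T.sig → (f t).OverSig T.sig)
    (hf' : ∀ t u, Compat T.RootStep T.EqRoot t u → Compat T.RootStep T.EqRoot (f t) (f u))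
    {t u : Term C ar} (h : T.Conv t u) : T.Conv (f t) (f u) := by
  rw [conv_iff] at h ⊢
  induction h with
  | refl t => exact .refl _
  | rel t u h => exact .rel _ _ ⟨hf _ h.1, hf _ h.2.1, hf' _ _ h.2.2⟩
  | symm _ _ _ ih => exact ih.symm
  | trans _ _ _ _ _ ih ih' => exact ih.trans _ _ _ ih'

section Congruence

variable {A A' B B' t t' u u' : Term C ar}

theorem pi (h : T.Conv A A') (h' : T.Conv B B') (hA : A'.OverSig T.sig) (hB : B.OverSig T.sig) :
    T.Conv (.pi A B) (.pi A' B') :=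
  (map (Term.pi · B) (fun _ h => ⟨h, hB⟩) (fun _ _ => .piL) h).trans
    (map (Term.pi A') (fun _ h => ⟨hA, h⟩) (fun _ _ => .piR) h')

theorem piC (h : T.Conv A A') (h' : T.Conv B B') (hA : A'.OverSig T.sig) (hB : B.OverSig T.sig) :
    T.Conv (.piC A B) (.piC A' B') :=
  (map (Term.piC · B) (fun _ h => ⟨h, hB⟩) (fun _ _ => .piCL) h).trans
    (map (Term.piC A') (fun _ h => ⟨hA, h⟩) (fun _ _ => .piCR) h')

theorem app (h : T.Conv t t') (h' : T.Conv u u') (ht : t'.OverSig T.sig) (hu : u.OverSig T.sig) :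
    T.Conv (.app t u) (.app t' u') :=
  (map (Term.app · u) (fun _ h => ⟨h, hu⟩) (fun _ _ => .appL) h).trans
    (map (Term.app t') (fun _ h => ⟨ht, h⟩) (fun _ _ => .appR) h')

theorem abs (h : T.Conv t t') : T.Conv (.abs t) (.abs t') :=
  map Term.abs (fun _ h => h) (fun _ _ => .abs) h

theorem absC (h : T.Conv t t') : T.Conv (.absC t) (.absC t') :=
  map Term.absC (fun _ h => h) (fun _ _ => .absC) h

theorem appC_left (h : T.Conv t t') {l : CTerm ar} (hl : l.Over (DeclaredInC T.sig)) :
    T.Conv (.appC t l) (.appC t' l) :=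
  map (Term.appC · l) (fun _ h => ⟨h, hl⟩) (fun _ _ => .appCL) h

theorem appC_right {l l' : CTerm ar} (h : T.ConvC l l') (ht : t.OverSig T.sig)
    (hT : ∀ l : CTerm ar, l.Over (DeclaredInC T.sig)) :
    T.Conv (.appC t l) (.appC t l') := by
  rw [conv_iff]
  induction h with
  | refl t => exact .refl _
  | rel l l' h => exact .rel _ _ ⟨⟨ht, hT _⟩, ⟨ht, hT _⟩, .appCR h⟩
  | symm _ _ _ ih => exact ih.symm
  | trans _ _ _ _ _ ih ih' => exact ih.trans _ _ _ ih'

end Congruence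

theorem subst (hT : T.Scoped) {t t' : Term C ar} (h : T.Conv t t') {σ : ℕ → Term C ar}
    {τ : ℕ → CTerm ar} (hs : SubstOver (DeclaredIn T.sig) (DeclaredInC T.sig) σ τ) :
    T.Conv (t.subst σ τ) (t'.subst σ τ) :=
  h.map (Term.subst σ τ) (fun _ h => Term.Over.subst h hs)
    fun _ _ h => h.subst (fun _ _ _ _ h => h.subst hT _ _) (fun _ _ _ h => h.subst _) _ _

theorem rename (hT : T.Scoped) {t t' : Term C ar} (h : T.Conv t t') (ρ ξ : ℕ → ℕ) :
    T.Conv (t.rename ρ ξ) (t'.rename ρ ξ) := by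
  simp only [Term.rename_eq_subst]
  exact h.subst hT (.of_renaming ρ ξ)

theorem inst (hT : T.Scoped) {t t' u : Term C ar} (h : T.Conv t t') (hu : u.OverSig T.sig) :
    T.Conv (t.inst u) (t'.inst u) := h.subst hT (.inst hu)

theorem instC (hT : T.Scoped) {t t' : Term C ar} {l : CTerm ar} (h : T.Conv t t')
    (hl : l.Over (DeclaredInC T.sig)) : T.Conv (t.instC l) (t'.instC l) :=
  h.subst hT (SubstOver.sconsC (.of_renaming id id) hl)

theorem subst_right (hT : T.Scoped) {t : Term C ar} (ht : t.OverSig T.sig)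
    {σ σ' : ℕ → Term C ar} {τ : ℕ → CTerm ar}
    (hs : SubstOver (DeclaredIn T.sig) (DeclaredInC T.sig) σ τ)
    (hs' : SubstOver (DeclaredIn T.sig) (DeclaredInC T.sig) σ' τ)
    (h : ∀ n, T.Conv (σ n) (σ' n)) : T.Conv (t.subst σ τ) (t.subst σ' τ) := by
  have h_up {σ σ' : ℕ → Term C ar} (h : ∀ n, T.Conv (σ n) (σ' n)) :
      ∀ n, T.Conv (up σ n) (up σ' n) := forall₂_scons (.refl _) fun n => (h n).rename hT _ _
  have h_upShiftC {σ σ' : ℕ → Term C ar} (h : ∀ n, T.Conv (σ n) (σ' n)) (n : ℕ) :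
      T.Conv (upShiftC σ n) (upShiftC σ' n) := (h n).rename hT _ _
  induction t generalizing σ σ' τ with
  | var n => exact h n
  | const c => exact .refl _
  | sort s => exact .refl _
  | pi A B ihA ihB =>
    exact (ihA ht.1 hs hs' h).pi (ihB ht.2 hs.up hs'.up (h_up h)) (ht.1.subst hs')
      (ht.2.subst hs.up)
  | abs t ih => exact (ih ht hs.up hs'.up (h_up h)).abs
  | app t u iht ihu =>
    exact (iht ht.1 hs hs' h).app (ihu ht.2 hs hs' h) (ht.1.subst hs') (ht.2.subst hs)
  | piC A B ihA ihB =>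
    exact (ihA ht.1 hs hs' h).piC (ihB ht.2 hs.upC hs'.upC (h_upShiftC h)) (ht.1.subst hs')
      (ht.2.subst hs.upC)
  | absC t ih => exact (ih ht hs.upC hs'.upC (h_upShiftC h)).absC
  | appC t l ih => exact (ih ht.1 hs hs' h).appC_left (ht.2.subst hs.conf)

theorem inst_right (hT : T.Scoped) {t u u' : Term C ar} (ht : t.OverSig T.sig)
    (hu : u.OverSig T.sig) (hu' : u'.OverSig T.sig) (h : T.Conv u u') :
    T.Conv (t.inst u) (t.inst u') :=
  .subst_right hT ht (.inst hu) (.inst hu') (forall₂_scons h fun _ => .refl _)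

end Conv

/-- The inclusion of theories. -/
structure Subtheory (T T' : Theory C ar) : Prop where
  sig : T.sig ⊆ T'.sig
  rules : T.rules ⊆ T'.rules
  eqs : T.eqs ⊆ T'.eqs

theorem Subtheory.overSig {T' : Theory C ar} (h : T.Subtheory T') {t : Term C ar}
    (ht : t.OverSig T.sig) : t.OverSig T'.sig :=
  ht.mono (fun _ => List.map_subset _ h.sig (a := _)) fun _ => List.map_subset _ h.sig (a := _)

theorem Subtheory.rootStep {T' : Theory C ar} (h : T.Subtheory T') {t u : Term C ar}
    (htu : T.RootStep t u) : T'.RootStep t u := by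
  cases htu with
  | beta t u => exact .beta t u
  | betaC t l => exact .betaC t l
  | rule hr => obtain ⟨hr, σ, τ⟩ := hr; exact .rule (.mk (h.rules hr) σ τ)
  | delta hd => exact .delta (h.sig hd)

theorem Subtheory.conv {T' : Theory C ar} (h : T.Subtheory T') {t u : Term C ar}
    (htu : T.Conv t u) : T'.Conv t u := by
  rw [conv_iff] at htu ⊢
  exact htu.mono fun _ _ ⟨ht, hu, hstep⟩ => ⟨h.overSig ht, h.overSig hu,
    hstep.mono (fun _ _ => h.rootStep) fun _ _ ⟨he, τ⟩ => .mk (h.eqs he) τ⟩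

end Theory

/-! ## Typing -/

section Typing

variable {T T' : Theory C ar} {Γ Δ : Ctx C ar} {A A' B t u : Term C ar} {l : CTerm ar}

mutual

theorem HasType.wfCtx {Γ : Ctx C ar} {t A : Term C ar} : HasType T Γ t A → WfCtx T Γ
  | .sort h => h
  | .var h _ => h
  | .const h _ => h
  | .defn h _ => h
  | .conv h _ _ => h.wfCtx
  | .pi h _ => h.wfCtx
  | .piC h _ => h.wfCtx
  | .abs h _ _ => h.wfCtx
  | .absC h _ _ => h.wfCtx
  | .app h _ => h.wfCtx
  | .appC h _ => h.wfCtx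

theorem HasTypeC.wfCtx {Γ : Ctx C ar} {l : CTerm ar} {A : Term C ar} :
    HasTypeC T Γ l A → WfCtx T Γ
  | .ivar h _ => h
  | .fn h _ _ => h
  | .conv h _ _ => h.wfCtx

end

theorem WfCtx.of_append : (Γ' : Ctx C ar) → WfCtx T (Γ' ++ Γ) → WfCtx T Γ
  | [], h => h
  | _ :: Γ', .ext h => of_append Γ' h.wfCtx
  | _ :: Γ', .extC h => of_append Γ' h.wfCtx

mutual

theorem WfCtx.mono (hs : T.Subtheory T') {Γ : Ctx C ar} : WfCtx T Γ → WfCtx T' Γ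
  | .empty => .empty
  | .ext h => .ext (h.mono hs)
  | .extC h => .extC (h.mono hs)

theorem HasType.mono (hs : T.Subtheory T') {Γ : Ctx C ar} {t A : Term C ar} :
    HasType T Γ t A → HasType T' Γ t A
  | .sort h => .sort (h.mono hs)
  | .var h hn => .var (h.mono hs) hn
  | .const h hc => .const (h.mono hs) (hs.sig hc)
  | .defn h hc => .defn (h.mono hs) (hs.sig hc)
  | .conv h hB hc => .conv (h.mono hs) (hB.mono hs) (hs.conv hc)
  | .pi hA hB => .pi (hA.mono hs) (hB.mono hs)
  | .piC hA hB => .piC (hA.mono hs) (hB.mono hs)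
  | .abs hA hB h => .abs (hA.mono hs) (hB.mono hs) (h.mono hs)
  | .absC hA hB h => .absC (hA.mono hs) (hB.mono hs) (h.mono hs)
  | .app h hu => .app (h.mono hs) (hu.mono hs)
  | .appC h hl => .appC (h.mono hs) (hl.mono hs)

theorem HasTypeC.mono (hs : T.Subtheory T') {Γ : Ctx C ar} {l : CTerm ar} {A : Term C ar} :
    HasTypeC T Γ l A → HasTypeC T' Γ l A
  | .ivar h hn => .ivar (h.mono hs) hn
  | .fn h hf hls => .fn (h.mono hs) (hs.sig hf) fun k => (hls k).mono hs
  | .conv h hB hc => .conv (h.mono hs) (hB.mono hs) (hs.conv hc)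

end

mutual

theorem HasType.overSig {Γ : Ctx C ar} {t A : Term C ar} : HasType T Γ t A → t.OverSig T.sig
  | .sort _ => trivial
  | .var _ _ => trivial
  | .const _ hc => List.mem_map_of_mem (f := Decl.name) hc
  | .defn _ hc => List.mem_map_of_mem (f := Decl.name) hc
  | .conv h _ _ => h.overSig
  | .pi hA hB => ⟨hA.overSig, hB.overSig⟩
  | .piC hA hB => ⟨hA.overSig, hB.overSig⟩
  | .abs _ _ h => h.overSig
  | .absC _ _ h => h.overSig
  | .app h hu => ⟨h.overSig, hu.overSig⟩
  | .appC h hl => ⟨h.overSig, hl.over⟩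

theorem HasTypeC.over {Γ : Ctx C ar} {l : CTerm ar} {A : Term C ar} :
    HasTypeC T Γ l A → l.Over (DeclaredInC T.sig)
  | .ivar _ _ => trivial
  | .fn _ hf hls => ⟨List.mem_map_of_mem (f := Decl.name) hf, fun k => (hls k).over⟩
  | .conv h _ _ => h.over

end

end Typing

/-! ## Scoping -/

section Scoping

variable {T : Theory C ar} {Γ : Ctx C ar} {A : Term C ar}

/-- Two substitutions agree on the variables of a context. -/
structure AgreeOn (Γ : Ctx C ar) (σ σ' : ℕ → Term C ar) (τ τ' : ℕ → CTerm ar) : Prop where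
  reg {n A} : LookupVar Γ n A → σ n = σ' n
  conf {n A} : LookupVarC Γ n A → τ n = τ' n

namespace AgreeOn

variable {σ σ' : ℕ → Term C ar} {τ τ' : ℕ → CTerm ar}

theorem up (h : AgreeOn Γ σ σ' τ τ') : AgreeOn (.reg A :: Γ) (up σ) (up σ') τ τ' where
  reg
    | .here => rfl
    | .thereReg hn => congrArg Term.shift (h.reg hn)
  conf
    | .thereReg hn => h.conf hn

theorem upC (h : AgreeOn Γ σ σ' τ τ') :
    AgreeOn (.conf A :: Γ) (upShiftC σ) (upShiftC σ') (upC τ) (upC τ') where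
  reg
    | .thereConf hn => congrArg Term.shiftC (h.reg hn)
  conf
    | .here => rfl
    | .thereConf hn => congrArg CTerm.shiftC (h.conf hn)

end AgreeOn

mutual

theorem HasType.subst_congr {Γ : Ctx C ar} {t A : Term C ar} {σ σ' : ℕ → Term C ar}
    {τ τ' : ℕ → CTerm ar} : HasType T Γ t A → AgreeOn Γ σ σ' τ τ' → t.subst σ τ = t.subst σ' τ'
  | .sort _, _ => rfl
  | .var _ hn, hs => hs.reg hn
  | .const _ _, _ => rfl
  | .defn _ _, _ => rfl
  | .conv h _ _, hs => h.subst_congr hs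
  | .pi hA hB, hs => congrArg₂ Term.pi (hA.subst_congr hs) (hB.subst_congr hs.up)
  | .piC hA hB, hs => congrArg₂ Term.piC (hA.subst_congr hs) (hB.subst_congr hs.upC)
  | .abs _ _ h, hs => congrArg Term.abs (h.subst_congr hs.up)
  | .absC _ _ h, hs => congrArg Term.absC (h.subst_congr hs.upC)
  | .app h hu, hs => congrArg₂ Term.app (h.subst_congr hs) (hu.subst_congr hs)
  | .appC h hl, hs => congrArg₂ Term.appC (h.subst_congr hs) (hl.subst_congr hs)

theorem HasTypeC.subst_congr {Γ : Ctx C ar} {l : CTerm ar} {A : Term C ar} {σ σ' : ℕ → Term C ar}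
    {τ τ' : ℕ → CTerm ar} : HasTypeC T Γ l A → AgreeOn Γ σ σ' τ τ' → l.subst τ = l.subst τ'
  | .ivar _ hn, hs => hs.conf hn
  | .fn _ _ hls, hs => congrArg (CTerm.fn _) (funext fun k => (hls k).subst_congr hs)
  | .conv h _ _, hs => h.subst_congr hs

end

/-- The context of confined variables of the types `Bs`. -/
def telescope (Bs : List (Term C ar)) : Ctx C ar := Bs.reverse.map Entry.conf

theorem telescope_concat (Bs : List (Term C ar)) (B : Term C ar) :
    telescope (Bs ++ [B]) = .conf B :: telescope Bs := by
  simp [telescope]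

theorem telescope_append (Bs Bs' : List (Term C ar)) :
    telescope (Bs ++ Bs') = telescope Bs' ++ telescope Bs := by
  simp [telescope]

theorem AgreeOn.telescope {σ σ' : ℕ → Term C ar} {τ τ' : ℕ → CTerm ar} (Bs : List (Term C ar))
    (h : ∀ n < Bs.length, τ n = τ' n) : AgreeOn (telescope Bs) σ σ' τ τ' := by
  have no_reg {Γ : Ctx C ar} {n A} (hn : LookupVar Γ n A) :
      ∃ B, Entry.reg B ∈ Γ := by
    induction hn with
    | here => exact ⟨_, List.mem_cons_self⟩
    | thereReg _ ih | thereConf _ ih =>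
      obtain ⟨B, hB⟩ := ih
      exact ⟨B, List.mem_cons_of_mem _ hB⟩
  have lt_length {Γ : Ctx C ar} {n A} (hn : LookupVarC Γ n A) : n < Γ.length := by
    induction hn with
    | here => exact Nat.zero_lt_succ _
    | thereReg _ ih => exact ih.trans (Nat.lt_succ_self _)
    | thereConf _ ih => exact Nat.succ_lt_succ ih
  refine ⟨fun hn => ?_, fun hn => h _ (by simpa [Dedukti.telescope] using lt_length hn)⟩
  obtain ⟨B, hB⟩ := no_reg hn
  simp [Dedukti.telescope] at hB

theorem HasType.scopedBelow {Bs : List (Term C ar)} {t A : Term C ar}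
    (h : HasType T (telescope Bs) t A) : t.ScopedBelow Bs.length :=
  fun _ _ _ _ hτ => h.subst_congr (.telescope Bs hτ)

theorem Decl.Valid.argType {f : F} {Δ : Fin (ar f) → Term C ar} (h : (Decl.conf f Δ A).Valid T)
    (k : Fin (ar f)) : HasType T (telescope ((List.ofFn Δ).take k)) (Δ k) (.sort .type) := by
  have hsplit : List.ofFn Δ = (List.ofFn Δ).take k ++ [Δ k] ++ (List.ofFn Δ).drop (k + 1) := by
    rw [List.append_assoc, List.singleton_append]
    conv_lhs => rw [← List.take_append_drop k (List.ofFn Δ),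
      List.drop_eq_getElem_cons (by simp), List.getElem_ofFn]
  have hΔ : WfCtx T (telescope (List.ofFn Δ)) := HasType.wfCtx h
  rw [hsplit, telescope_append, telescope_concat] at hΔ
  cases hΔ.of_append with
  | extC h => exact h

/-- `A` is the type of a term in `Γ`: it has a sort or is `Kind`. -/
def IsType (T : Theory C ar) (Γ : Ctx C ar) (A : Term C ar) : Prop :=
  A = .sort .kind ∨ ∃ s, HasType T Γ A (.sort s)

/-- Every entry of the signature is valid in the whole theory, and the types of the constants are
types. -/
structure WellTyped (T : Theory C ar) : Prop where
  valid {d} : d ∈ T.sig → d.Valid T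
  isType {c A} : T.Declares c A → IsType T [] A

theorem WellTyped.scoped (hT : WellTyped T) : T.Scoped where
  type hc := by
    rcases hT.isType hc with rfl | ⟨s, h⟩
    · exact fun _ _ _ _ _ => rfl
    · exact h.scopedBelow (Bs := [])
  body hc := HasType.scopedBelow (Bs := []) (hT.valid hc)
  argType hf k := by
    have h := (Decl.Valid.argType (hT.valid hf) k).scopedBelow
    rwa [List.length_take_of_le (by simp [k.isLt.le])] at h
  resultType hf := by
    have h := HasType.scopedBelow (hT.valid hf)
    rwa [List.length_ofFn] at h

end Scoping

/-! ## Typing is stable under substitution -/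

theorem Term.ScopedBelow.prefixSubst_subst {A : Term C ar} {n k : ℕ} (hA : A.ScopedBelow k)
    (ls : Fin n → CTerm ar) (hk : k ≤ n) (σ : ℕ → Term C ar) (τ : ℕ → CTerm ar) :
    (A.subst .var (prefixSubst ls k hk)).subst σ τ =
      A.subst .var (prefixSubst (fun j => (ls j).subst τ) k hk) := by
  rw [Term.subst_subst]
  exact hA _ _ _ _ fun m hm => by simp only [prefixSubst, hm, dif_pos]

section Substitution

variable {T : Theory C ar} {Γ Δ : Ctx C ar} {A A' B t u : Term C ar} {l : CTerm ar} {s : Srt}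
  {σ : ℕ → Term C ar} {τ : ℕ → CTerm ar}

/-- `σ, τ` is a well-typed substitution from `Γ` to `Δ`. -/
structure TypedSubst (T : Theory C ar) (Δ : Ctx C ar) (σ : ℕ → Term C ar) (τ : ℕ → CTerm ar)
    (Γ : Ctx C ar) : Prop where
  wfCtx : WfCtx T Δ
  reg {n A} : LookupVar Γ n A → HasType T Δ (σ n) (A.subst σ τ)
  conf {n A} : LookupVarC Γ n A → HasTypeC T Δ (τ n) (A.subst σ τ)
  substOver : SubstOver (DeclaredIn T.sig) (DeclaredInC T.sig) σ τ

/-- A class of well-typed substitutions that is stable under binders.  Typing is shown to be stable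
under any such class, since the stability of all well-typed substitutions under binders already
depends on the case of renamings. -/
structure SubstClass (T : Theory C ar)
    (S : Ctx C ar → (ℕ → Term C ar) → (ℕ → CTerm ar) → Ctx C ar → Prop) : Prop where
  typed {Δ Γ : Ctx C ar} {σ : ℕ → Term C ar} {τ : ℕ → CTerm ar} : S Δ σ τ Γ → TypedSubst T Δ σ τ Γ
  up {Δ Γ : Ctx C ar} {σ : ℕ → Term C ar} {τ : ℕ → CTerm ar} {A : Term C ar} :
    S Δ σ τ Γ → HasType T Δ (A.subst σ τ) (.sort .type) →
    S (.reg (A.subst σ τ) :: Δ) (up σ) τ (.reg A :: Γ)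
  upC {Δ Γ : Ctx C ar} {σ : ℕ → Term C ar} {τ : ℕ → CTerm ar} {A : Term C ar} :
    S Δ σ τ Γ → HasType T Δ (A.subst σ τ) (.sort .type) →
    S (.conf (A.subst σ τ) :: Δ) (upShiftC σ) (upC τ) (.conf A :: Γ)

section

variable {S : Ctx C ar → (ℕ → Term C ar) → (ℕ → CTerm ar) → Ctx C ar → Prop}

mutual

theorem SubstClass.hasType (hT : T.Scoped) (hS : SubstClass T S) {Γ Δ : Ctx C ar}
    {t A : Term C ar} {σ : ℕ → Term C ar} {τ : ℕ → CTerm ar} :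
    HasType T Γ t A → S Δ σ τ Γ → HasType T Δ (t.subst σ τ) (A.subst σ τ)
  | .sort _, hs => .sort (hS.typed hs).wfCtx
  | .var _ hn, hs => (hS.typed hs).reg hn
  | .const _ hc, hs => by
    rw [(hT.type (.inl hc)).subst_eq]
    exact .const (hS.typed hs).wfCtx hc
  | .defn _ hc, hs => by
    rw [(hT.type (.inr ⟨_, hc⟩)).subst_eq]
    exact .defn (hS.typed hs).wfCtx hc
  | .conv h hB hc, hs =>
    .conv (hS.hasType hT h hs) (hS.hasType hT hB hs) (hc.subst hT (hS.typed hs).substOver)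
  | .pi hA hB, hs =>
    have hA := hS.hasType hT hA hs
    .pi hA (hS.hasType hT hB (hS.up hs hA))
  | .piC hA hB, hs =>
    have hA := hS.hasType hT hA hs
    .piC hA (hS.hasType hT hB (hS.upC hs hA))
  | .abs hA hB h, hs =>
    have hA := hS.hasType hT hA hs
    .abs hA (hS.hasType hT hB (hS.up hs hA)) (hS.hasType hT h (hS.up hs hA))
  | .absC hA hB h, hs =>
    have hA := hS.hasType hT hA hs
    .absC hA (hS.hasType hT hB (hS.upC hs hA)) (hS.hasType hT h (hS.upC hs hA))
  | .app h hu, hs => by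
    rw [Term.inst_subst]
    exact .app (hS.hasType hT h hs) (hS.hasType hT hu hs)
  | .appC h hl, hs => by
    rw [Term.instC_subst]
    exact .appC (hS.hasType hT h hs) (hS.hasTypeC hT hl hs)

theorem SubstClass.hasTypeC (hT : T.Scoped) (hS : SubstClass T S) {Γ Δ : Ctx C ar}
    {l : CTerm ar} {A : Term C ar} {σ : ℕ → Term C ar} {τ : ℕ → CTerm ar} :
    HasTypeC T Γ l A → S Δ σ τ Γ → HasTypeC T Δ (l.subst τ) (A.subst σ τ)
  | .ivar _ hn, hs => (hS.typed hs).conf hn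
  | .fn _ hf hls, hs => by
    rw [(hT.resultType hf).prefixSubst_subst]
    refine .fn (hS.typed hs).wfCtx hf fun k => ?_
    rw [← (hT.argType hf k).prefixSubst_subst]
    exact hS.hasTypeC hT (hls k) hs
  | .conv h hB hc, hs =>
    .conv (hS.hasTypeC hT h hs) (hS.hasType hT hB hs) (hc.subst hT (hS.typed hs).substOver)

end

end

/-- `ρ, ξ` is a renaming of the variables of `Γ` by variables of `Δ` of the same types. -/
structure TypedRenaming (T : Theory C ar) (Δ : Ctx C ar) (ρ ξ : ℕ → ℕ) (Γ : Ctx C ar) : Prop where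
  wfCtx : WfCtx T Δ
  reg {n A} : LookupVar Γ n A → LookupVar Δ (ρ n) (A.rename ρ ξ)
  conf {n A} : LookupVarC Γ n A → LookupVarC Δ (ξ n) (A.rename ρ ξ)

namespace TypedRenaming

variable {ρ ξ : ℕ → ℕ}

theorem typedSubst (h : TypedRenaming T Δ ρ ξ Γ) :
    TypedSubst T Δ (fun n => .var (ρ n)) (fun n => .ivar (ξ n)) Γ where
  wfCtx := h.wfCtx
  reg hn := .var h.wfCtx (Term.rename_eq_subst _ _ _ ▸ h.reg hn)
  conf hn := .ivar h.wfCtx (Term.rename_eq_subst _ _ _ ▸ h.conf hn)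
  substOver := .of_renaming ρ ξ

theorem up (h : TypedRenaming T Δ ρ ξ Γ) (hA : HasType T Δ (A.rename ρ ξ) (.sort .type)) :
    TypedRenaming T (.reg (A.rename ρ ξ) :: Δ) (liftRen ρ) ξ (.reg A :: Γ) where
  wfCtx := .ext hA
  reg
    | .here => Term.shift_rename A ρ ξ ▸ .here
    | .thereReg hn => Term.shift_rename _ ρ ξ ▸ .thereReg (h.reg hn)
  conf
    | .thereReg hn => Term.shift_rename _ ρ ξ ▸ .thereReg (h.conf hn)

theorem upC (h : TypedRenaming T Δ ρ ξ Γ) (hA : HasType T Δ (A.rename ρ ξ) (.sort .type)) :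
    TypedRenaming T (.conf (A.rename ρ ξ) :: Δ) ρ (liftRen ξ) (.conf A :: Γ) where
  wfCtx := .extC hA
  reg
    | .thereConf hn => Term.shiftC_rename _ ρ ξ ▸ .thereConf (h.reg hn)
  conf
    | .here => Term.shiftC_rename A ρ ξ ▸ .here
    | .thereConf hn => Term.shiftC_rename _ ρ ξ ▸ .thereConf (h.conf hn)

theorem substClass : SubstClass T fun Δ σ τ Γ => ∃ ρ ξ, σ = (fun n => .var (ρ n)) ∧
    τ = (fun n => .ivar (ξ n)) ∧ TypedRenaming T Δ ρ ξ Γ where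
  typed := by
    rintro _ _ _ _ ⟨ρ, ξ, rfl, rfl, h⟩
    exact h.typedSubst
  up := by
    rintro _ _ _ _ A ⟨ρ, ξ, rfl, rfl, h⟩ hA
    rw [← Term.rename_eq_subst] at hA ⊢
    exact ⟨_, _, up_var ρ, rfl, h.up hA⟩
  upC := by
    rintro _ _ _ _ A ⟨ρ, ξ, rfl, rfl, h⟩ hA
    rw [← Term.rename_eq_subst] at hA ⊢
    exact ⟨_, _, upShiftC_var ρ, upC_ivar ξ, h.upC hA⟩

theorem shift (hA : HasType T Γ A (.sort .type)) :
    TypedRenaming T (.reg A :: Γ) Nat.succ id Γ :=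
  ⟨.ext hA, .thereReg, .thereReg⟩

theorem shiftC (hA : HasType T Γ A (.sort .type)) :
    TypedRenaming T (.conf A :: Γ) id Nat.succ Γ :=
  ⟨.extC hA, .thereConf, .thereConf⟩

end TypedRenaming

theorem HasType.rename (hT : T.Scoped) {ρ ξ : ℕ → ℕ} (h : HasType T Γ t A)
    (hs : TypedRenaming T Δ ρ ξ Γ) : HasType T Δ (t.rename ρ ξ) (A.rename ρ ξ) := by
  rw [Term.rename_eq_subst, Term.rename_eq_subst]
  exact TypedRenaming.substClass.hasType hT h ⟨_, _, rfl, rfl, hs⟩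

theorem HasTypeC.rename (hT : T.Scoped) {ρ ξ : ℕ → ℕ} (h : HasTypeC T Γ l A)
    (hs : TypedRenaming T Δ ρ ξ Γ) : HasTypeC T Δ (l.rename ξ) (A.rename ρ ξ) := by
  rw [CTerm.rename_eq_subst, Term.rename_eq_subst]
  exact TypedRenaming.substClass.hasTypeC hT h ⟨_, _, rfl, rfl, hs⟩

theorem HasType.shift (hT : T.Scoped) (h : HasType T Γ t B) (hA : HasType T Γ A (.sort .type)) :
    HasType T (.reg A :: Γ) t.shift B.shift := h.rename hT (.shift hA)

theorem HasType.shiftC (hT : T.Scoped) (h : HasType T Γ t B) (hA : HasType T Γ A (.sort .type)) :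
    HasType T (.conf A :: Γ) t.shiftC B.shiftC := h.rename hT (.shiftC hA)

theorem HasTypeC.shift (hT : T.Scoped) (h : HasTypeC T Γ l B) (hA : HasType T Γ A (.sort .type)) :
    HasTypeC T (.reg A :: Γ) l B.shift :=
  l.rename_id ▸ h.rename hT (.shift hA)

theorem HasTypeC.shiftC (hT : T.Scoped) (h : HasTypeC T Γ l B)
    (hA : HasType T Γ A (.sort .type)) : HasTypeC T (.conf A :: Γ) l.shiftC B.shiftC :=
  h.rename hT (.shiftC hA)

namespace TypedSubst

theorem id (h : WfCtx T Γ) : TypedSubst T Γ .var .ivar Γ where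
  wfCtx := h
  reg hn := .var h (by rwa [Term.subst_id])
  conf hn := .ivar h (by rwa [Term.subst_id])
  substOver := .of_renaming _ _

theorem scons (h : TypedSubst T Δ σ τ Γ) (hu : HasType T Δ u (A.subst σ τ)) :
    TypedSubst T Δ (scons u σ) τ (.reg A :: Γ) where
  wfCtx := h.wfCtx
  reg
    | .here => A.shift_subst_scons u σ τ ▸ hu
    | .thereReg hn => Term.shift_subst_scons _ u σ τ ▸ h.reg hn
  conf
    | .thereReg hn => Term.shift_subst_scons _ u σ τ ▸ h.conf hn
  substOver := ⟨forall_scons hu.overSig h.substOver.reg, h.substOver.conf⟩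

theorem sconsC (h : TypedSubst T Δ σ τ Γ) (hl : HasTypeC T Δ l (A.subst σ τ)) :
    TypedSubst T Δ σ (Dedukti.scons l τ) (.conf A :: Γ) where
  wfCtx := h.wfCtx
  reg
    | .thereConf hn => Term.shiftC_subst_scons _ l σ τ ▸ h.reg hn
  conf
    | .here => A.shiftC_subst_scons l σ τ ▸ hl
    | .thereConf hn => Term.shiftC_subst_scons _ l σ τ ▸ h.conf hn
  substOver := h.substOver.sconsC hl.over

theorem shift (hT : T.Scoped) (h : TypedSubst T Δ σ τ Γ) (hA : HasType T Δ A (.sort .type)) :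
    TypedSubst T (.reg A :: Δ) (fun n => (σ n).shift) τ Γ where
  wfCtx := .ext hA
  reg hn := by
    have := (h.reg hn).shift hT hA
    rwa [Term.shift, Term.shift, Term.rename_subst, funext fun n => (τ n).rename_id] at this
  conf hn := by
    have := (h.conf hn).shift hT hA
    rwa [Term.shift, Term.rename_subst, funext fun n => (τ n).rename_id] at this
  substOver := ⟨fun n => (h.substOver.reg n).rename _ _, h.substOver.conf⟩

theorem shiftC (hT : T.Scoped) (h : TypedSubst T Δ σ τ Γ) (hA : HasType T Δ A (.sort .type)) :
    TypedSubst T (.conf A :: Δ) (upShiftC σ) (fun n => (τ n).shiftC) Γ where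
  wfCtx := .extC hA
  reg hn := by
    have := (h.reg hn).shiftC hT hA
    rwa [Term.shiftC, Term.shiftC, Term.rename_subst] at this
  conf hn := by
    have := (h.conf hn).shiftC hT hA
    rwa [Term.shiftC, Term.rename_subst] at this
  substOver := ⟨fun n => (h.substOver.reg n).rename _ _, fun n => (h.substOver.conf n).rename _⟩

theorem up (hT : T.Scoped) (h : TypedSubst T Δ σ τ Γ)
    (hA : HasType T Δ (A.subst σ τ) (.sort .type)) :
    TypedSubst T (.reg (A.subst σ τ) :: Δ) (up σ) τ (.reg A :: Γ) := by
  refine (h.shift hT hA).scons (.var (.ext hA) ?_)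
  have hvar : LookupVar (.reg (A.subst σ τ) :: Δ) 0 (A.subst σ τ).shift := .here
  rwa [Term.shift, Term.rename_subst, funext fun n => (τ n).rename_id] at hvar

theorem upC (hT : T.Scoped) (h : TypedSubst T Δ σ τ Γ)
    (hA : HasType T Δ (A.subst σ τ) (.sort .type)) :
    TypedSubst T (.conf (A.subst σ τ) :: Δ) (upShiftC σ) (upC τ) (.conf A :: Γ) := by
  refine (h.shiftC hT hA).sconsC (.ivar (.extC hA) ?_)
  have hvar : LookupVarC (.conf (A.subst σ τ) :: Δ) 0 (A.subst σ τ).shiftC := .here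
  rwa [Term.shiftC, Term.rename_subst] at hvar

theorem substClass (hT : T.Scoped) : SubstClass T (TypedSubst T) where
  typed h := h
  up h := h.up hT
  upC h := h.upC hT

end TypedSubst

theorem HasType.subst (hT : T.Scoped) (h : HasType T Γ t A) (hs : TypedSubst T Δ σ τ Γ) :
    HasType T Δ (t.subst σ τ) (A.subst σ τ) := (TypedSubst.substClass hT).hasType hT h hs

theorem HasType.inst (hT : T.Scoped) (h : HasType T (.reg A :: Γ) t B) (hu : HasType T Γ u A) :
    HasType T Γ (t.inst u) (B.inst u) :=
  h.subst hT ((TypedSubst.id hu.wfCtx).scons (by rwa [Term.subst_id]))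

theorem HasType.instC (hT : T.Scoped) (h : HasType T (.conf A :: Γ) t B)
    (hl : HasTypeC T Γ l A) : HasType T Γ (t.instC l) (B.instC l) :=
  h.subst hT ((TypedSubst.id hl.wfCtx).sconsC (by rwa [Term.subst_id]))

theorem HasType.weaken_nil (hT : T.Scoped) (h : HasType T [] t A) (hA : A.ScopedBelow 0)
    (hΓ : WfCtx T Γ) : HasType T Γ t A := by
  have ht : t.ScopedBelow 0 := h.scopedBelow (Bs := [])
  have h' := h.rename hT (ρ := id) (ξ := id) (Δ := Γ) ⟨hΓ, nofun, nofun⟩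
  rwa [Term.rename_eq_subst, ht.subst_eq, Term.rename_eq_subst, hA.subst_eq] at h'

theorem HasType.ctx_reg (hT : T.Scoped) (h : HasType T (.reg A :: Γ) t B)
    (hA : HasType T Γ A (.sort .type)) (hA' : HasType T Γ A' (.sort .type)) (hc : T.Conv A' A) :
    HasType T (.reg A' :: Γ) t B := by
  have hs : TypedSubst T (.reg A' :: Γ) (Dedukti.up .var) .ivar (.reg A :: Γ) := by
    refine ((TypedSubst.id hA.wfCtx).shift hT hA').scons ?_
    have hvar : HasType T (.reg A' :: Γ) (.var 0) A.shift :=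
      .conv (.var (.ext hA') .here) (hA.shift hT hA') (hc.rename hT _ _)
    rwa [Term.shift_eq_subst] at hvar
  simpa using h.subst hT hs

theorem HasType.ctx_conf (hT : T.Scoped) (h : HasType T (.conf A :: Γ) t B)
    (hA : HasType T Γ A (.sort .type)) (hA' : HasType T Γ A' (.sort .type)) (hc : T.Conv A' A) :
    HasType T (.conf A' :: Γ) t B := by
  have hs : TypedSubst T (.conf A' :: Γ) .var (Dedukti.upC .ivar) (.conf A :: Γ) := by
    refine ((TypedSubst.id hA.wfCtx).shiftC hT hA').sconsC ?_
    have hvar : HasTypeC T (.conf A' :: Γ) (.ivar 0) A.shiftC :=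
      .conv (.ivar (.extC hA') .here) (hA.shiftC hT hA') (hc.rename hT _ _)
    rwa [Term.shiftC_eq_subst] at hvar
  simpa using h.subst hT hs

theorem prefixSubst_succ {n : ℕ} (ls : Fin n → CTerm ar) (k : ℕ) (hk : k < n) :
    prefixSubst ls (k + 1) hk = scons (ls ⟨k, hk⟩) (prefixSubst ls k hk.le) := by
  funext m
  cases m with
  | zero => simp [prefixSubst, scons]
  | succ m =>
    simp only [prefixSubst, scons, Nat.add_lt_add_iff_right, Nat.add_sub_add_right,
      Nat.add_sub_cancel, Nat.sub_sub, Nat.add_comm 1]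

theorem TypedSubst.prefixSubst {f : F} {Bs : Fin (ar f) → Term C ar} {ls : Fin (ar f) → CTerm ar}
    (hΓ : WfCtx T Γ)
    (hls : ∀ k : Fin (ar f), HasTypeC T Γ (ls k) ((Bs k).subst .var (prefixSubst ls k k.isLt.le))) :
    ∀ k (hk : k ≤ ar f), TypedSubst T Γ .var (prefixSubst ls k hk)
      (telescope ((List.ofFn Bs).take k))
  | 0, _ => ⟨hΓ, nofun, nofun, .of_renaming _ _⟩
  | k + 1, hk => by
    have hlast : (List.ofFn Bs).take (k + 1) = (List.ofFn Bs).take k ++ [Bs ⟨k, hk⟩] := by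
      rw [List.take_succ_eq_append_getElem (by simpa using hk), List.getElem_ofFn]
    rw [hlast, telescope_concat, prefixSubst_succ]
    exact (prefixSubst hΓ hls k _).sconsC (hls ⟨k, hk⟩)

end Substitution

/-! ## Generation and correctness of types -/

section Generation

variable {T T' : Theory C ar} {Γ : Ctx C ar} {A B D t u : Term C ar} {l : CTerm ar}

/-- Equality or conversion to a type of `Γ`: the effect of repeated uses of the conversion rule. -/
def ConvType (T : Theory C ar) (Γ : Ctx C ar) (A B : Term C ar) : Prop :=
  A = B ∨ T.Conv A B ∧ ∃ s, HasType T Γ B (.sort s)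

namespace ConvType

theorem conv (h : ConvType T Γ A B) : T.Conv A B := by
  rcases h with rfl | h
  exacts [.refl _, h.1]

theorem trans (h : ConvType T Γ A B) (h' : ConvType T Γ B D) : ConvType T Γ A D := by
  rcases h' with rfl | h'
  exacts [h, .inr ⟨h.conv.trans h'.1, h'.2⟩]

theorem hasType (h : ConvType T Γ A B) (ht : HasType T Γ t A) : HasType T Γ t B := by
  rcases h with rfl | ⟨h, s, hB⟩
  exacts [ht, .conv ht hB h]

end ConvType

/-- `t` has type `D` in `Γ` by a derivation that does not end with the conversion rule. -/
def SyntaxDirected (T : Theory C ar) (Γ : Ctx C ar) : Term C ar → Term C ar → Prop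
  | .var n, D => LookupVar Γ n D
  | .const c, D => T.Declares c D
  | .sort s, D => s = .type ∧ D = .sort .kind
  | .pi A B, D => ∃ s, HasType T Γ A (.sort .type) ∧ HasType T (.reg A :: Γ) B (.sort s) ∧
      D = .sort s
  | .piC A B, D => ∃ s, HasType T Γ A (.sort .type) ∧ HasType T (.conf A :: Γ) B (.sort s) ∧
      D = .sort s
  | .abs t, D => ∃ A B s, HasType T Γ A (.sort .type) ∧ HasType T (.reg A :: Γ) B (.sort s) ∧
      HasType T (.reg A :: Γ) t B ∧ D = .pi A B
  | .absC t, D => ∃ A B s, HasType T Γ A (.sort .type) ∧ HasType T (.conf A :: Γ) B (.sort s) ∧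
      HasType T (.conf A :: Γ) t B ∧ D = .piC A B
  | .app t u, D => ∃ A B, HasType T Γ t (.pi A B) ∧ HasType T Γ u A ∧ D = B.inst u
  | .appC t l, D => ∃ A B, HasType T Γ t (.piC A B) ∧ HasTypeC T Γ l A ∧ D = B.instC l

theorem HasType.generation {Γ : Ctx C ar} {t D : Term C ar} :
    HasType T Γ t D → ∃ D', SyntaxDirected T Γ t D' ∧ ConvType T Γ D' D
  | .sort _ => ⟨_, ⟨rfl, rfl⟩, .inl rfl⟩
  | .var _ hn => ⟨_, hn, .inl rfl⟩
  | .const _ hc => ⟨_, .inl hc, .inl rfl⟩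
  | .defn _ hc => ⟨_, .inr ⟨_, hc⟩, .inl rfl⟩
  | .conv h hB hc =>
    have ⟨D', hD', h⟩ := h.generation
    ⟨D', hD', h.trans (.inr ⟨hc, _, hB⟩)⟩
  | .pi hA hB => ⟨_, ⟨_, hA, hB, rfl⟩, .inl rfl⟩
  | .piC hA hB => ⟨_, ⟨_, hA, hB, rfl⟩, .inl rfl⟩
  | .abs hA hB h => ⟨_, ⟨_, _, _, hA, hB, h, rfl⟩, .inl rfl⟩
  | .absC hA hB h => ⟨_, ⟨_, _, _, hA, hB, h, rfl⟩, .inl rfl⟩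
  | .app h hu => ⟨_, ⟨_, _, h, hu, rfl⟩, .inl rfl⟩
  | .appC h hl => ⟨_, ⟨_, _, h, hl, rfl⟩, .inl rfl⟩

theorem LookupVar.hasType (hT : T.Scoped) {Γ : Ctx C ar} {n : ℕ} {A : Term C ar} :
    LookupVar Γ n A → WfCtx T Γ → HasType T Γ A (.sort .type)
  | .here, .ext hA => hA.shift hT hA
  | .thereReg h, .ext hB => (h.hasType hT hB.wfCtx).shift hT hB
  | .thereConf h, .extC hB => (h.hasType hT hB.wfCtx).shiftC hT hB

theorem LookupVarC.hasType (hT : T.Scoped) {Γ : Ctx C ar} {n : ℕ} {A : Term C ar} :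
    LookupVarC Γ n A → WfCtx T Γ → HasType T Γ A (.sort .type)
  | .here, .extC hA => hA.shiftC hT hA
  | .thereReg h, .ext hB => (h.hasType hT hB.wfCtx).shift hT hB
  | .thereConf h, .extC hB => (h.hasType hT hB.wfCtx).shiftC hT hB

theorem isType_sort (hΓ : WfCtx T Γ) : (s : Srt) → IsType T Γ (.sort s)
  | .type => .inr ⟨.kind, .sort hΓ⟩
  | .kind => .inl rfl

theorem IsType.of_pi (h : IsType T Γ (.pi A B)) :
    ∃ s, HasType T Γ A (.sort .type) ∧ HasType T (.reg A :: Γ) B (.sort s) := by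
  obtain ⟨_, h⟩ := h.resolve_left nofun
  obtain ⟨_, ⟨s, hA, hB, _⟩, _⟩ := h.generation
  exact ⟨s, hA, hB⟩

theorem IsType.of_piC (h : IsType T Γ (.piC A B)) :
    ∃ s, HasType T Γ A (.sort .type) ∧ HasType T (.conf A :: Γ) B (.sort s) := by
  obtain ⟨_, h⟩ := h.resolve_left nofun
  obtain ⟨_, ⟨s, hA, hB, _⟩, _⟩ := h.generation
  exact ⟨s, hA, hB⟩

theorem WellTyped.isType_declares (hT : WellTyped T) (hΓ : WfCtx T Γ) {c : C}
    (hc : T.Declares c A) : IsType T Γ A :=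
  (hT.isType hc).imp_right fun ⟨s, h⟩ => ⟨s, h.weaken_nil hT.scoped (fun _ _ _ _ _ => rfl) hΓ⟩

theorem HasType.isType (hT : WellTyped T) {Γ : Ctx C ar} {t A : Term C ar} :
    HasType T Γ t A → IsType T Γ A
  | .sort _ => .inl rfl
  | .var hΓ hn => .inr ⟨_, hn.hasType hT.scoped hΓ⟩
  | .const hΓ hc => hT.isType_declares hΓ (.inl hc)
  | .defn hΓ hc => hT.isType_declares hΓ (.inr ⟨_, hc⟩)
  | .conv _ hB _ => .inr ⟨_, hB⟩
  | .pi hA _ => isType_sort hA.wfCtx _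
  | .piC hA _ => isType_sort hA.wfCtx _
  | .abs hA hB _ => .inr ⟨_, .pi hA hB⟩
  | .absC hA hB _ => .inr ⟨_, .piC hA hB⟩
  | .app h hu =>
    have ⟨s, _, hB⟩ := (h.isType hT).of_pi
    .inr ⟨s, hB.inst hT.scoped hu⟩
  | .appC h hl =>
    have ⟨s, _, hB⟩ := (h.isType hT).of_piC
    .inr ⟨s, hB.instC hT.scoped hl⟩

theorem HasTypeC.isType (hT : WellTyped T) : HasTypeC T Γ l A → HasType T Γ A (.sort .type)
  | .ivar hΓ hn => hn.hasType hT.scoped hΓ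
  | .fn hΓ hf hls => by
    have hs := TypedSubst.prefixSubst hΓ hls _ le_rfl
    rw [List.take_of_length_le (List.length_ofFn).le] at hs
    exact HasType.subst hT.scoped (hT.valid hf) hs
  | .conv _ hB _ => hB

theorem IsType.overSig (h : IsType T Γ A) : A.OverSig T.sig := by
  rcases h with rfl | ⟨s, h⟩
  exacts [trivial, h.overSig]

theorem IsType.convType (hB : IsType T Γ B) (h : T.Conv A B) (hne : B ≠ .sort .kind) :
    ConvType T Γ A B :=
  .inr ⟨h, hB.resolve_left hne⟩

end Generation

/-! ## Well-formed theories -/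

section WellFormed

variable {T T' : Theory C ar} {S S' : List (Decl C ar)}

theorem Decl.Valid.mono (hs : T.Subtheory T') {d : Decl C ar} (h : d.Valid T) : d.Valid T' := by
  cases d with
  | const c A => exact h.imp fun _ h => h.mono hs
  | defn c A t => exact HasType.mono hs h
  | conf f Δ A => exact HasType.mono hs h

theorem IsType.mono (hs : T.Subtheory T') {Γ : Ctx C ar} {A : Term C ar} (h : IsType T Γ A) :
    IsType T' Γ A :=
  h.imp_right fun ⟨s, h⟩ => ⟨s, h.mono hs⟩

theorem Theory.restrict_subtheory (h : S ⊆ S') :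
    (T.restrict S).Subtheory (T.restrict S') where
  sig := h
  rules := fun _ ⟨hr, hlhs, hrhs⟩ =>
    have hsub : (T.restrict S).sig.map Decl.name ⊆ S'.map Decl.name := List.map_subset _ h
    ⟨hr, hlhs.mono (fun _ => (hsub ·)) fun _ => (hsub ·),
      hrhs.mono (fun _ => (hsub ·)) fun _ => (hsub ·)⟩
  eqs := fun _ ⟨he, hl, hr⟩ =>
    have hsub : (T.restrict S).sig.map Decl.name ⊆ S'.map Decl.name := List.map_subset _ h
    ⟨he, hl.mono fun _ => (hsub ·), hr.mono fun _ => (hsub ·)⟩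

theorem WellTyped.concat {d : Decl C ar} (hS : WellTyped (T.restrict S))
    (hd : d.Valid (T.restrict S)) : WellTyped (T.restrict (S ++ [d])) := by
  have hs : (T.restrict S).Subtheory (T.restrict (S ++ [d])) :=
    Theory.restrict_subtheory (List.subset_append_left _ _)
  have mem {d'} (h : d' ∈ S ++ [d]) : d' ∈ S ∨ d' = d := by simpa using h
  constructor
  · intro d' h
    rcases mem h with h | rfl
    exacts [(hS.valid h).mono hs, hd.mono hs]
  · rintro c A (h | ⟨t, h⟩) <;> rcases mem h with h | rfl
    · exact (hS.isType (.inl h)).mono hs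
    · exact (IsType.mono hs (.inr hd))
    · exact (hS.isType (.inr ⟨t, h⟩)).mono hs
    · exact (HasType.isType hS hd).mono hs

theorem Theory.WellFormed.wellTyped (hT : T.WellFormed) : WellTyped T := by
  have hprefix : ∀ S S', T.sig = S ++ S' → WellTyped (T.restrict S) := by
    intro S
    induction S using List.reverseRecOn with
    | nil => exact fun _ _ => ⟨nofun, nofun⟩
    | append_singleton S d ih =>
      intro S' hS
      rw [List.append_assoc, List.singleton_append] at hS
      exact (ih _ hS).concat (hT.2 _ _ _ hS)
  have hsig : WellTyped (T.restrict T.sig) := hprefix T.sig [] (List.append_nil _).symm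
  have hs : (T.restrict T.sig).Subtheory T := ⟨fun _ => id, fun _ h => h.1, fun _ h => h.1⟩
  exact ⟨fun h => (hsig.valid h).mono hs, fun h => (hsig.isType h).mono hs⟩

theorem Theory.WellFormed.decl_unique (hT : T.WellFormed) {d d' : Decl C ar} (hd : d ∈ T.sig)
    (hd' : d' ∈ T.sig) (h : d.name = d'.name) : d = d' :=
  List.inj_on_of_nodup_map hT.1 hd hd' h

theorem Theory.WellFormed.declares_unique (hT : T.WellFormed) {c : C} {A B : Term C ar}
    (hA : T.Declares c A) (hB : T.Declares c B) : A = B := by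
  rcases hA with hA | ⟨t, hA⟩ <;> rcases hB with hB | ⟨u, hB⟩ <;>
    cases hT.decl_unique hA hB rfl <;> rfl

end WellFormed

/-! ## Subject reduction from injectivity of products -/

namespace Term

theorem subst_up_inst (B u : Term C ar) (σ : ℕ → Term C ar) (τ : ℕ → CTerm ar) :
    (B.subst (up σ) τ).inst u = B.subst (scons u σ) τ := by
  simp only [inst, subst_subst, CTerm.subst_id]
  congr 1
  funext n
  cases n
  · rfl
  · exact shift_inst _ _

theorem subst_upC_instC (B : Term C ar) (l : CTerm ar) (σ : ℕ → Term C ar) (τ : ℕ → CTerm ar) :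
    (B.subst (upShiftC σ) (upC τ)).instC l = B.subst σ (scons l τ) := by
  simp only [instC, subst_subst]
  congr 1
  · funext n; exact shiftC_instC _ _
  · funext n
    cases n
    · rfl
    · simp only [upC, scons, CTerm.shiftC, CTerm.subst_rename]
      exact CTerm.subst_id _

end Term

/-- Convertible products of the theory have convertible components. -/
structure Theory.PiInjective (T : Theory C ar) : Prop where
  pi {A B A' B' : Term C ar} : T.Conv (.pi A B) (.pi A' B') → (Term.pi A B).OverSig T.sig →
    (Term.pi A' B').OverSig T.sig → T.Conv A A' ∧ T.Conv B B'
  piC {A B A' B' : Term C ar} : T.Conv (.piC A B) (.piC A' B') → (Term.piC A B).OverSig T.sig →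
    (Term.piC A' B').OverSig T.sig → T.Conv A A' ∧ T.Conv B B'

section SubjectReduction

variable {T : Theory C ar} {Γ : Ctx C ar} {A B A' B' D t u : Term C ar} {l : CTerm ar}

theorem Theory.PiInjective.inst (hinj : T.PiInjective) (hT : WellTyped T)
    (h : IsType T Γ (.pi A B)) (h' : IsType T Γ (.pi A' B'))
    (hconv : T.Conv (.pi A B) (.pi A' B')) (hu : HasType T Γ u A') :
    HasType T Γ u A ∧ ConvType T Γ (B.inst u) (B'.inst u) := by
  obtain ⟨_, hA, _⟩ := h.of_pi
  obtain ⟨s, _, hB'⟩ := h'.of_pi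
  obtain ⟨hAA', hBB'⟩ := hinj.pi hconv h.overSig h'.overSig
  exact ⟨.conv hu hA hAA'.symm,
    .inr ⟨hBB'.inst hT.scoped hu.overSig, s, hB'.inst hT.scoped hu⟩⟩

theorem Theory.PiInjective.instC (hinj : T.PiInjective) (hT : WellTyped T)
    (h : IsType T Γ (.piC A B)) (h' : IsType T Γ (.piC A' B'))
    (hconv : T.Conv (.piC A B) (.piC A' B')) (hl : HasTypeC T Γ l A') :
    HasTypeC T Γ l A ∧ ConvType T Γ (B.instC l) (B'.instC l) := by
  obtain ⟨_, hA, _⟩ := h.of_piC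
  obtain ⟨s, _, hB'⟩ := h'.of_piC
  obtain ⟨hAA', hBB'⟩ := hinj.piC hconv h.overSig h'.overSig
  exact ⟨.conv hl hA hAA'.symm,
    .inr ⟨hBB'.instC hT.scoped hl.over, s, hB'.instC hT.scoped hl⟩⟩

/-- If `t` has a type in `Γ`, then `A` is one, and all the others are obtained from `A` by
conversion. -/
def Principal (T : Theory C ar) (Γ : Ctx C ar) (t A : Term C ar) : Prop :=
  ∀ D, HasType T Γ t D → HasType T Γ t A ∧ ConvType T Γ A D

namespace Principal

theorem const (hT : T.WellFormed) {c : C} (hc : Decl.const c A ∈ T.sig) :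
    Principal T Γ (.const c) A := by
  intro D h
  obtain ⟨A', hA', hD⟩ := h.generation
  obtain rfl := hT.declares_unique (.inl hc) hA'
  exact ⟨.const h.wfCtx hc, hD⟩

variable {σ : ℕ → Term C ar} {τ : ℕ → CTerm ar}

theorem app_inv (hinj : T.PiInjective) (hT : WellTyped T)
    (ht : Principal T Γ t ((Term.pi A B).subst σ τ)) (h : HasType T Γ (.app t u) D) :
    HasType T Γ t ((Term.pi A B).subst σ τ) ∧ HasType T Γ u (A.subst σ τ) ∧
      ConvType T Γ (B.subst (scons u σ) τ) D := by
  obtain ⟨_, ⟨A', B', ht', hu, rfl⟩, hD⟩ := h.generation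
  obtain ⟨htA, hc⟩ := ht _ ht'
  obtain ⟨hu, hB⟩ := hinj.inst hT (htA.isType hT) (ht'.isType hT) hc.conv hu
  exact ⟨htA, hu, Term.subst_up_inst B u σ τ ▸ hB.trans hD⟩

theorem app (hinj : T.PiInjective) (hT : WellTyped T)
    (ht : Principal T Γ t ((Term.pi A B).subst σ τ)) :
    Principal T Γ (.app t u) (B.subst (scons u σ) τ) := fun _ h =>
  have ⟨htA, hu, hD⟩ := ht.app_inv hinj hT h
  ⟨Term.subst_up_inst B u σ τ ▸ htA.app hu, hD⟩

theorem appC_inv (hinj : T.PiInjective) (hT : WellTyped T)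
    (ht : Principal T Γ t ((Term.piC A B).subst σ τ)) (h : HasType T Γ (.appC t l) D) :
    HasType T Γ t ((Term.piC A B).subst σ τ) ∧ HasTypeC T Γ l (A.subst σ τ) ∧
      ConvType T Γ (B.subst σ (scons l τ)) D := by
  obtain ⟨_, ⟨A', B', ht', hl, rfl⟩, hD⟩ := h.generation
  obtain ⟨htA, hc⟩ := ht _ ht'
  obtain ⟨hl, hB⟩ := hinj.instC hT (htA.isType hT) (ht'.isType hT) hc.conv hl
  exact ⟨htA, hl, Term.subst_upC_instC B l σ τ ▸ hB.trans hD⟩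

theorem appC (hinj : T.PiInjective) (hT : WellTyped T)
    (ht : Principal T Γ t ((Term.piC A B).subst σ τ)) :
    Principal T Γ (.appC t l) (B.subst σ (scons l τ)) := fun _ h =>
  have ⟨htA, hl, hD⟩ := ht.appC_inv hinj hT h
  ⟨Term.subst_upC_instC B l σ τ ▸ htA.appC hl, hD⟩

end Principal

theorem HasType.beta (hinj : T.PiInjective) (hT : WellTyped T)
    (h : HasType T Γ (.app (.abs t) u) D) : HasType T Γ (t.inst u) D := by
  obtain ⟨_, ⟨A', B', ht', hu, rfl⟩, hD⟩ := h.generation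
  obtain ⟨_, ⟨A, B, s, hA, hB, ht, rfl⟩, hc⟩ := ht'.generation
  obtain ⟨hu, hBB'⟩ := hinj.inst hT (.inr ⟨s, .pi hA hB⟩) (ht'.isType hT) hc.conv hu
  exact hD.hasType (hBB'.hasType (ht.inst hT.scoped hu))

theorem HasType.betaC (hinj : T.PiInjective) (hT : WellTyped T)
    (h : HasType T Γ (.appC (.absC t) l) D) : HasType T Γ (t.instC l) D := by
  obtain ⟨_, ⟨A', B', ht', hl, rfl⟩, hD⟩ := h.generation
  obtain ⟨_, ⟨A, B, s, hA, hB, ht, rfl⟩, hc⟩ := ht'.generation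
  obtain ⟨hl, hBB'⟩ := hinj.instC hT (.inr ⟨s, .piC hA hB⟩) (ht'.isType hT) hc.conv hl
  exact hD.hasType (hBB'.hasType (ht.instC hT.scoped hl))

theorem HasType.delta (hT : T.WellFormed) {c : C} (hc : Decl.defn c A t ∈ T.sig)
    (h : HasType T Γ (.const c) D) : HasType T Γ t D := by
  obtain ⟨A', hA', hD⟩ := h.generation
  obtain rfl := hT.declares_unique (.inr ⟨t, hc⟩) hA'
  have hscoped := hT.wellTyped.scoped
  exact hD.hasType (HasType.weaken_nil hscoped (hT.wellTyped.valid hc)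
    (hscoped.type (.inr ⟨t, hc⟩)) h.wfCtx)

theorem HasType.rootStep (hT : T.WellFormed) (hinj : T.PiInjective)
    (hrule : ∀ {Γ t t' D}, T.RuleRoot t t' → HasType T Γ t D → HasType T Γ t' D)
    {t' : Term C ar} (h : HasType T Γ t D) (hs : T.RootStep t t') : HasType T Γ t' D := by
  cases hs with
  | beta => exact h.beta hinj hT.wellTyped
  | betaC => exact h.betaC hinj hT.wellTyped
  | rule hs => exact hrule hs h
  | delta hc => exact h.delta hT hc

theorem HasType.app_of_conv (hT : WellTyped T) {u' : Term C ar} (ht : HasType T Γ t (.pi A B))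
    (hu : HasType T Γ u A) (hu' : HasType T Γ u' A) (hc : T.Conv u' u) :
    HasType T Γ (.app t u') (B.inst u) := by
  obtain ⟨s, _, hB⟩ := (ht.isType hT).of_pi
  exact .conv (.app ht hu') (hB.inst hT.scoped hu)
    (.inst_right hT.scoped hB.overSig hu'.overSig hu.overSig hc)

theorem HasType.ctxClosure (hT : WellTyped T)
    (hroot : ∀ {Γ t t' D}, T.RootStep t t' → HasType T Γ t D → HasType T Γ t' D)
    {t' : Term C ar} (h : HasType T Γ t D) (hs : CtxClosure T.RootStep t t') :
    HasType T Γ t' D := by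
  have convBack {Γ : Ctx C ar} {t t' D D' : Term C ar} (h : HasType T Γ t D)
      (h' : HasType T Γ t' D') (hs : CtxClosure T.RootStep t t') : T.Conv t' t :=
    (Theory.Conv.of_step h.overSig h'.overSig hs).symm
  induction hs generalizing Γ D with
  | root hs => exact hroot hs h
  | piL hs ih =>
    obtain ⟨_, ⟨s, hA, hB, rfl⟩, hD⟩ := h.generation
    exact hD.hasType (.pi (ih hA) (hB.ctx_reg hT.scoped hA (ih hA) (convBack hA (ih hA) hs)))
  | piR _ ih =>
    obtain ⟨_, ⟨s, hA, hB, rfl⟩, hD⟩ := h.generation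
    exact hD.hasType (.pi hA (ih hB))
  | abs _ ih =>
    obtain ⟨_, ⟨A, B, s, hA, hB, ht, rfl⟩, hD⟩ := h.generation
    exact hD.hasType (.abs hA hB (ih ht))
  | appL _ ih =>
    obtain ⟨_, ⟨A, B, ht, hu, rfl⟩, hD⟩ := h.generation
    exact hD.hasType (.app (ih ht) hu)
  | appR hs ih =>
    obtain ⟨_, ⟨A, B, ht, hu, rfl⟩, hD⟩ := h.generation
    exact hD.hasType (ht.app_of_conv hT hu (ih hu) (convBack hu (ih hu) hs))
  | piCL hs ih =>
    obtain ⟨_, ⟨s, hA, hB, rfl⟩, hD⟩ := h.generation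
    exact hD.hasType (.piC (ih hA) (hB.ctx_conf hT.scoped hA (ih hA) (convBack hA (ih hA) hs)))
  | piCR _ ih =>
    obtain ⟨_, ⟨s, hA, hB, rfl⟩, hD⟩ := h.generation
    exact hD.hasType (.piC hA (ih hB))
  | absC _ ih =>
    obtain ⟨_, ⟨A, B, s, hA, hB, ht, rfl⟩, hD⟩ := h.generation
    exact hD.hasType (.absC hA hB (ih ht))
  | appCL _ ih =>
    obtain ⟨_, ⟨A, B, ht, hl, rfl⟩, hD⟩ := h.generation
    exact hD.hasType (.appC (ih ht) hl)
  | appCR hs =>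
    obtain ⟨_, _, h, _⟩ := hs.exists_root
    exact h.elim

theorem HasType.step (hT : T.WellFormed) (hinj : T.PiInjective)
    (hrule : ∀ {Γ t t' D}, T.RuleRoot t t' → HasType T Γ t D → HasType T Γ t' D)
    {t' : Term C ar} (h : HasType T Γ t D) (hs : T.Step t t') : HasType T Γ t' D :=
  h.ctxClosure hT.wellTyped (fun hs h => h.rootStep hT hinj hrule hs) (Theory.step_iff.1 hs)

end SubjectReduction

end Dedukti

namespace UPP

open Dedukti Relation

universe w

variable {L : Type w}

/-- A well-formed theory that extends the signature of UPP by arbitrary declarations and has the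
rewrite rules of UPP, with arbitrary equations between levels. -/
structure IsExtension (T : Theory (Const L) arity) : Prop where
  wellFormed : T.WellFormed
  sig_subset : sig L ⊆ T.sig
  rules_eq : T.rules = {ruleU L, ruleBeta L}

variable {T : Theory (Const L) arity}

theorem ty_mem_sig : .const .Ty tyType ∈ sig L := by simp [sig]

theorem tm_mem_sig : .const .Tm tmType ∈ sig L := by simp [sig]

theorem u_mem_sig : .const .U uType ∈ sig L := by simp [sig]

theorem pi_mem_sig : .const .Pi piType ∈ sig L := by simp [sig]

theorem lam_mem_sig : .const .Lam lamType ∈ sig L := by simp [sig]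

theorem app_mem_sig : .const .App appType ∈ sig L := by simp [sig]

theorem IsExtension.wellTyped (hT : IsExtension T) : WellTyped T := hT.wellFormed.wellTyped

theorem IsExtension.scoped (hT : IsExtension T) : T.Scoped := hT.wellTyped.scoped

theorem IsExtension.not_defn (hT : IsExtension T) {c : Const L} {A B t : Trm L}
    (hc : Decl.const c A ∈ sig L) : Decl.defn c B t ∉ T.sig := fun h =>
  nomatch hT.wellFormed.decl_unique (hT.sig_subset hc) h rfl

theorem IsExtension.declaredIn (hT : IsExtension T) {c : Const L} {A : Trm L}
    (hc : Decl.const c A ∈ sig L) : DeclaredIn T.sig c :=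
  List.mem_map_of_mem (f := Decl.name) (hT.sig_subset hc)

theorem IsExtension.level_over (hT : IsExtension T) (l : Level) : l.Over (DeclaredInC T.sig) := by
  induction l with
  | ivar => trivial
  | fn f ls ih =>
    refine ⟨List.map_subset _ hT.sig_subset ?_, ih⟩
    cases f <;> simp [sig, Decl.name]

/-! ## Parallel reduction modulo the equations on levels -/

/-- `c l l' A B`, the common prefix of the terms formed with `Π`, `λ` and `@`. -/
abbrev applyFamily (c : Const L) (l l' : Level) (A B : Trm L) : Trm L :=
  .app (.app (.appC (.appC (.const c) l) l') A) B

/-- Parallel reduction, up to conversion of levels. -/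
inductive Par (T : Theory (Const L) arity) : Trm L → Trm L → Prop
  | var (n) : Par T (.var n) (.var n)
  | const (c) : Par T (.const c) (.const c)
  | sort (s) : Par T (.sort s) (.sort s)
  | pi {A A' B B'} : Par T A A' → Par T B B' → Par T (.pi A B) (.pi A' B')
  | abs {t t'} : Par T t t' → Par T (.abs t) (.abs t')
  | app {t t' u u'} : Par T t t' → Par T u u' → Par T (.app t u) (.app t' u')
  | piC {A A' B B'} : Par T A A' → Par T B B' → Par T (.piC A B) (.piC A' B')
  | absC {t t'} : Par T t t' → Par T (.absC t) (.absC t')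
  | appC {t t' l l'} : Par T t t' → T.ConvC l l' → Par T (.appC t l) (.appC t' l')
  | beta {t t' u u'} : Par T t t' → Par T u u' → Par T (.app (.abs t) u) (t'.inst u')
  | betaC {t t' l l'} : Par T t t' → T.ConvC l l' → Par T (.appC (.absC t) l) (t'.instC l')
  | delta {c A t} : Decl.defn c A t ∈ T.sig → Par T (.const c) t
  | tmU {k l l'} : T.ConvC l l' →
      Par T (.app (.appC (.const .Tm) k) (.appC (.const .U) l)) (.appC (.const .Ty) l')
  | appLam {l l' k k' A B A' B' t t' u u'} : Par T t t' → Par T u u' →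
      Par T (.app (.app (applyFamily .App l l' A B) (.app (applyFamily .Lam k k' A' B') t)) u)
        (.app t' u')

namespace Par

theorem refl (t : Trm L) : Par T t t := by
  induction t with
  | var n => exact .var n
  | const c => exact .const c
  | sort s => exact .sort s
  | pi _ _ h h' => exact .pi h h'
  | abs _ h => exact .abs h
  | app _ _ h h' => exact .app h h'
  | piC _ _ h h' => exact .piC h h'
  | absC _ h => exact .absC h
  | appC _ l h => exact .appC h (.refl l)

/-- Stated for a class `S` because the lifting of a pair of substitutions under a binder requires
the case of equal substitutions first. -/
theorem subst_of_class (hT : T.Scoped)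
    {S : (ℕ → Trm L) → (ℕ → Trm L) → (ℕ → Level) → (ℕ → Level) → Prop}
    (hS : ∀ {σ σ' τ τ'}, S σ σ' τ τ' → (∀ n, Par T (σ n) (σ' n)) ∧ ∀ n, T.ConvC (τ n) (τ' n))
    (hup : ∀ {σ σ' τ τ'}, S σ σ' τ τ' → S (up σ) (up σ') τ τ')
    (hupC : ∀ {σ σ' τ τ'}, S σ σ' τ τ' → S (upShiftC σ) (upShiftC σ') (upC τ) (upC τ'))
    {t t' : Trm L} (h : Par T t t') {σ σ' τ τ'} (hs : S σ σ' τ τ') :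
    Par T (t.subst σ τ) (t'.subst σ' τ') := by
  induction h generalizing σ σ' τ τ' with
  | var n => exact (hS hs).1 n
  | const c => exact .const c
  | sort s => exact .sort s
  | pi _ _ h h' => exact .pi (h hs) (h' (hup hs))
  | abs _ h => exact .abs (h (hup hs))
  | app _ _ h h' => exact .app (h hs) (h' hs)
  | piC _ _ h h' => exact .piC (h hs) (h' (hupC hs))
  | absC _ h => exact .absC (h (hupC hs))
  | appC _ hl h => exact .appC (h hs) (hl.subst (hS hs).2)
  | beta _ _ h h' => rw [Term.inst_subst]; exact .beta (h (hup hs)) (h' hs)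
  | betaC _ hl h => rw [Term.instC_subst]; exact .betaC (h (hupC hs)) (hl.subst (hS hs).2)
  | delta h => rw [(hT.body h).subst_eq]; exact .delta h
  | tmU hl => exact .tmU (hl.subst (hS hs).2)
  | appLam _ _ h h' => exact .appLam (h hs) (h' hs)

theorem subst_left (hT : T.Scoped) {t t' : Trm L} (h : Par T t t') (σ : ℕ → Trm L)
    (τ : ℕ → Level) : Par T (t.subst σ τ) (t'.subst σ τ) :=
  h.subst_of_class hT (S := fun σ σ' τ τ' => σ = σ' ∧ τ = τ')
    (by rintro _ _ _ _ ⟨rfl, rfl⟩; exact ⟨fun _ => refl _, fun _ => .refl _⟩)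
    (by rintro _ _ _ _ ⟨rfl, rfl⟩; exact ⟨rfl, rfl⟩)
    (by rintro _ _ _ _ ⟨rfl, rfl⟩; exact ⟨rfl, rfl⟩) ⟨rfl, rfl⟩

theorem subst (hT : T.Scoped) {t t' : Trm L} (h : Par T t t') {σ σ' : ℕ → Trm L}
    {τ τ' : ℕ → Level} (hσ : ∀ n, Par T (σ n) (σ' n)) (hτ : ∀ n, T.ConvC (τ n) (τ' n)) :
    Par T (t.subst σ τ) (t'.subst σ' τ') := by
  refine h.subst_of_class hT (S := fun σ σ' τ τ' =>
    (∀ n, Par T (σ n) (σ' n)) ∧ ∀ n, T.ConvC (τ n) (τ' n)) id ?_ ?_ ⟨hσ, hτ⟩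
  · rintro _ _ _ _ ⟨hσ, hτ⟩
    refine ⟨forall₂_scons (.var 0) fun n => ?_, hτ⟩
    simp only [Term.shift_eq_subst]
    exact (hσ n).subst_left hT _ _
  · rintro _ _ _ _ ⟨hσ, hτ⟩
    refine ⟨fun n => ?_, forall₂_scons (.refl _) fun n => ?_⟩
    · simp only [upShiftC, Term.shiftC_eq_subst]
      exact (hσ n).subst_left hT _ _
    · simp only [CTerm.shiftC, CTerm.rename_eq_subst]
      exact (hτ n).subst fun _ => .refl _

theorem inst (hT : T.Scoped) {t t' u u' : Trm L} (h : Par T t t') (h' : Par T u u') :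
    Par T (t.inst u) (t'.inst u') :=
  h.subst hT (forall₂_scons h' .var) fun _ => .refl _

theorem instC (hT : T.Scoped) {t t' : Trm L} {l l' : Level} (h : Par T t t')
    (h' : T.ConvC l l') : Par T (t.instC l) (t'.instC l') :=
  h.subst hT .var (forall₂_scons h' fun _ => .refl _)

theorem of_compat (hT : IsExtension T) {t t' : Trm L}
    (h : Compat T.RootStep T.EqRoot t t') : Par T t t' := by
  induction h with
  | root h =>
    rcases h with ⟨t, u⟩ | ⟨t, l⟩ | ⟨hr, σ, τ⟩ | hc
    · exact .beta (refl _) (refl _)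
    · exact .betaC (refl _) (.refl _)
    · rw [hT.rules_eq] at hr
      rcases hr with rfl | rfl
      · exact .tmU (.refl _)
      · exact .appLam (refl _) (refl _)
    · exact .delta hc
  | piL _ h => exact .pi h (refl _)
  | piR _ h => exact .pi (refl _) h
  | abs _ h => exact .abs h
  | appL _ h => exact .app h (refl _)
  | appR _ h => exact .app (refl _) h
  | piCL _ h => exact .piC h (refl _)
  | piCR _ h => exact .piC (refl _) h
  | absC _ h => exact .absC h
  | appCL _ h => exact .appC h (.refl _)
  | appCR h => exact .appC (refl _) (.rel _ _ h)

section Inversion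

variable {c : Const L} {l l' k k' : Level} {A B A' B' C t u x : Trm L}

theorem const_inv (hT : IsExtension T) (hc : Decl.const c C ∈ sig L)
    (h : Par T (.const c) x) : x = .const c := by
  cases h with
  | const => rfl
  | delta h => exact absurd h (hT.not_defn hc)

theorem appC_const_inv (hT : IsExtension T) (hc : Decl.const c C ∈ sig L)
    (h : Par T (.appC (.const c) l) x) : ∃ l', x = .appC (.const c) l' ∧ T.ConvC l l' := by
  cases h with
  | appC h hl => exact ⟨_, by rw [const_inv hT hc h], hl⟩

theorem applyFamily_inv (hT : IsExtension T) (hc : Decl.const c C ∈ sig L)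
    (h : Par T (applyFamily c l l' A B) x) :
    ∃ k k' A' B', x = applyFamily c k k' A' B' ∧
      T.ConvC l k ∧ T.ConvC l' k' ∧ Par T A A' ∧ Par T B B' := by
  cases h with
  | app h hB =>
    cases h with
    | app h hA =>
      cases h with
      | appC h hl' =>
        obtain ⟨_, rfl, hl⟩ := appC_const_inv hT hc h
        exact ⟨_, _, _, _, rfl, hl, hl', hA, hB⟩

theorem app_applyFamily_inv (hT : IsExtension T) (hc : Decl.const c C ∈ sig L)
    (h : Par T (.app (applyFamily c l l' A B) t) x) :
    ∃ k k' A' B' t', x = .app (applyFamily c k k' A' B') t' ∧ Par T t t' := by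
  cases h with
  | app h ht =>
    obtain ⟨_, _, _, _, rfl, -⟩ := applyFamily_inv hT hc h
    exact ⟨_, _, _, _, _, rfl, ht⟩

end Inversion

end Par

/-! ## Confluence by complete developments -/

/-- Every parallel reduct of `t` reduces in parallel to `v`: the complete development of `t` in the
sense of Takahashi, which is determined up to conversion of levels. -/
def IsDevelopment (T : Theory (Const L) arity) (t v : Trm L) : Prop :=
  ∀ u, Par T t u → Par T u v

theorem Par.app_applyFamily_app_inv (hT : IsExtension T) {l l' k k' : Level}
    {A B A' B' t x : Trm L}
    (h : Par T (.app (applyFamily .App l l' A B) (.app (applyFamily .Lam k k' A' B') t)) x) :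
    ∃ m m' n n' C D C' D' t', Par T t t' ∧
      x = .app (applyFamily .App m m' C D) (.app (applyFamily .Lam n n' C' D') t') := by
  obtain ⟨_, _, _, _, _, rfl, hlam⟩ := app_applyFamily_inv hT app_mem_sig h
  obtain ⟨_, _, _, _, _, rfl, ht⟩ := app_applyFamily_inv hT lam_mem_sig hlam
  exact ⟨_, _, _, _, _, _, _, _, _, ht, rfl⟩

namespace IsDevelopment

variable {A A' B B' t t' u u' v : Trm L} {l l' k k' : Level}

theorem pi (hA : IsDevelopment T A A') (hB : IsDevelopment T B B') :
    IsDevelopment T (.pi A B) (.pi A' B')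
  | _, .pi h h' => .pi (hA _ h) (hB _ h')

theorem piC (hA : IsDevelopment T A A') (hB : IsDevelopment T B B') :
    IsDevelopment T (.piC A B) (.piC A' B')
  | _, .piC h h' => .piC (hA _ h) (hB _ h')

theorem abs (h : IsDevelopment T t t') : IsDevelopment T (.abs t) (.abs t')
  | _, .abs ht => .abs (h _ ht)

theorem absC (h : IsDevelopment T t t') : IsDevelopment T (.absC t) (.absC t')
  | _, .absC ht => .absC (h _ ht)

theorem of_abs (h : IsDevelopment T (.abs t) v) : ∃ t', IsDevelopment T t t' := by
  cases h _ (.refl _) with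
  | @abs _ t' _ => exact ⟨t', fun _ ht => by cases h _ (.abs ht); assumption⟩

theorem of_absC (h : IsDevelopment T (.absC t) v) : ∃ t', IsDevelopment T t t' := by
  cases h _ (.refl _) with
  | @absC _ t' _ => exact ⟨t', fun _ ht => by cases h _ (.absC ht); assumption⟩

theorem of_app_lam (hT : IsExtension T)
    (h : IsDevelopment T
      (.app (applyFamily .App l l' A B) (.app (applyFamily .Lam k k' A' B') t)) v) :
    ∃ t', IsDevelopment T t t' := by
  obtain ⟨_, _, _, _, _, _, _, _, t', -, rfl⟩ := (h _ (.refl _)).app_applyFamily_app_inv hT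
  refine ⟨t', fun u ht => ?_⟩
  have hu := h _ (.app (.refl _) (.app (.refl _) ht))
  obtain ⟨_, _, _, _, _, _, _, _, _, hu, heq⟩ := hu.app_applyFamily_app_inv hT
  cases heq
  exact hu

theorem appC (ht : IsDevelopment T t t') (hne : ∀ s, t ≠ .absC s) :
    IsDevelopment T (.appC t l) (.appC t' l)
  | _, .appC h hl => .appC (ht _ h) hl.symm
  | _, .betaC _ _ => absurd rfl (hne _)

theorem betaC (hT : IsExtension T) (ht : IsDevelopment T t t') :
    IsDevelopment T (.appC (.absC t) l) (t'.instC l)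
  | _, .appC (.absC h) hl => .betaC (ht _ h) hl.symm
  | _, .betaC h hl => (ht _ h).instC hT.scoped hl.symm

theorem beta (hT : IsExtension T) (ht : IsDevelopment T t t') (hu : IsDevelopment T u u') :
    IsDevelopment T (.app (.abs t) u) (t'.inst u')
  | _, .app (.abs h) h' => .beta (ht _ h) (hu _ h')
  | _, .beta h h' => (ht _ h).inst hT.scoped (hu _ h')

theorem tmU (hT : IsExtension T) :
    IsDevelopment T (.app (.appC (.const .Tm) k) (.appC (.const .U) l)) (.appC (.const .Ty) l) := by
  intro _ h
  cases h with
  | app h h' =>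
    obtain ⟨_, rfl, -⟩ := h.appC_const_inv hT tm_mem_sig
    obtain ⟨_, rfl, hl⟩ := h'.appC_const_inv hT u_mem_sig
    exact .tmU hl.symm
  | tmU hl => exact .appC (.const _) hl.symm

theorem appLam (hT : IsExtension T) (ht : IsDevelopment T t t') (hu : IsDevelopment T u u') :
    IsDevelopment T
      (.app (.app (applyFamily .App l l' A B) (.app (applyFamily .Lam k k' A' B') t)) u)
      (.app t' u') := by
  intro _ h
  cases h with
  | app h h' =>
    obtain ⟨_, _, _, _, _, _, _, _, _, hs, rfl⟩ := h.app_applyFamily_app_inv hT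
    exact .appLam (ht _ hs) (hu _ h')
  | appLam h h' => exact .app (ht _ h) (hu _ h')

theorem app (ht : IsDevelopment T t t') (hu : IsDevelopment T u u') (habs : ∀ s, t ≠ .abs s)
    (hU : ∀ k l, ¬ (t = .appC (.const .Tm) k ∧ u = .appC (.const .U) l))
    (hlam : ∀ l l' k k' A B A' B' s,
      t ≠ .app (applyFamily .App l l' A B) (.app (applyFamily .Lam k k' A' B') s)) :
    IsDevelopment T (.app t u) (.app t' u')
  | _, .app h h' => .app (ht _ h) (hu _ h')
  | _, .beta _ _ => absurd rfl (habs _)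
  | _, .tmU _ => absurd ⟨rfl, rfl⟩ (hU _ _)
  | _, .appLam _ _ => absurd rfl (hlam _ _ _ _ _ _ _ _ _)

theorem exists_const (hT : IsExtension T) (c : Const L) :
    ∃ v, IsDevelopment T (.const c) v := by
  by_cases hc : ∃ A t, Decl.defn c A t ∈ T.sig
  · obtain ⟨A, t, hc⟩ := hc
    refine ⟨t, fun _ h => ?_⟩
    cases h with
    | const => exact .delta hc
    | delta h => cases hT.wellFormed.decl_unique h hc rfl; exact .refl _
  · refine ⟨.const c, fun _ h => ?_⟩
    cases h with
    | const => exact .refl _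
    | delta h => exact absurd ⟨_, _, h⟩ hc

theorem exists_app (hT : IsExtension T) (ht : IsDevelopment T t t') (hu : IsDevelopment T u u') :
    ∃ v, IsDevelopment T (.app t u) v := by
  by_cases habs : ∃ s, t = .abs s
  · obtain ⟨s, rfl⟩ := habs
    obtain ⟨_, hs⟩ := ht.of_abs
    exact ⟨_, hs.beta hT hu⟩
  by_cases hU : ∃ k l, t = .appC (.const .Tm) k ∧ u = .appC (.const .U) l
  · obtain ⟨k, l, rfl, rfl⟩ := hU
    exact ⟨_, .tmU hT⟩
  by_cases hlam : ∃ l l' k k' A B A' B' s,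
      t = .app (applyFamily .App l l' A B) (.app (applyFamily .Lam k k' A' B') s)
  · obtain ⟨_, _, _, _, _, _, _, _, _, rfl⟩ := hlam
    obtain ⟨_, hs⟩ := ht.of_app_lam hT
    exact ⟨_, hs.appLam hT hu⟩
  push Not at habs hU hlam
  exact ⟨_, ht.app hu habs (fun k l h => hU k l h.1 h.2) hlam⟩

theorem exists_appC (hT : IsExtension T) (ht : IsDevelopment T t t') :
    ∃ v, IsDevelopment T (.appC t l) v := by
  by_cases habs : ∃ s, t = .absC s
  · obtain ⟨s, rfl⟩ := habs
    obtain ⟨_, hs⟩ := ht.of_absC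
    exact ⟨_, hs.betaC hT⟩
  · exact ⟨_, ht.appC (not_exists.1 habs)⟩

theorem exists_development (hT : IsExtension T) (t : Trm L) : ∃ v, IsDevelopment T t v := by
  induction t with
  | var n => exact ⟨.var n, fun | _, .var n => .var n⟩
  | const c => exact exists_const hT c
  | sort s => exact ⟨.sort s, fun | _, .sort s => .sort s⟩
  | pi _ _ ih ih' =>
    obtain ⟨_, hA⟩ := ih
    obtain ⟨_, hB⟩ := ih'
    exact ⟨_, hA.pi hB⟩
  | abs _ ih => exact ih.elim fun _ h => ⟨_, h.abs⟩
  | app _ _ ih ih' =>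
    obtain ⟨_, ht⟩ := ih
    obtain ⟨_, hu⟩ := ih'
    exact exists_app hT ht hu
  | piC _ _ ih ih' =>
    obtain ⟨_, hA⟩ := ih
    obtain ⟨_, hB⟩ := ih'
    exact ⟨_, hA.piC hB⟩
  | absC _ ih => exact ih.elim fun _ h => ⟨_, h.absC⟩
  | appC _ l ih => exact ih.elim fun _ h => exists_appC hT h

end IsDevelopment

theorem Par.diamond (hT : IsExtension T) {t u₁ u₂ : Trm L} (h₁ : Par T t u₁) (h₂ : Par T t u₂) :
    ∃ v, Par T u₁ v ∧ Par T u₂ v := by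
  obtain ⟨v, hv⟩ := IsDevelopment.exists_development hT t
  exact ⟨v, hv _ h₁, hv _ h₂⟩

theorem IsExtension.join_of_conv (hT : IsExtension T) {t u : Trm L} (h : T.Conv t u) :
    Join (ReflTransGen (Par T)) t u := by
  have heq := equivalence_join_reflTransGen (r := Par T) fun _ _ _ hb hc =>
    have ⟨v, hbv, hcv⟩ := Par.diamond hT hb hc
    ⟨v, .single hbv, .single hcv⟩
  rw [Theory.conv_iff] at h
  induction h with
  | refl t => exact heq.refl t
  | rel t u h => exact ⟨u, .single (.of_compat hT h.2.2), .refl⟩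
  | symm _ _ _ ih => exact heq.symm ih
  | trans _ _ _ _ _ ih ih' => exact heq.trans ih ih'

/-! ## Injectivity of type formers -/

section Injectivity

variable {A A' B B' t t' u : Trm L} {l l' k k' m m' : Level}

theorem Par.overSig (hT : IsExtension T) {t t' : Trm L} :
    Par T t t' → t.OverSig T.sig → t'.OverSig T.sig
  | .var _, h => h
  | .const _, h => h
  | .sort _, h => h
  | .pi h h', ho => ⟨h.overSig hT ho.1, h'.overSig hT ho.2⟩
  | .piC h h', ho => ⟨h.overSig hT ho.1, h'.overSig hT ho.2⟩
  | .app h h', ho => ⟨h.overSig hT ho.1, h'.overSig hT ho.2⟩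
  | .abs h, ho => h.overSig hT ho
  | .absC h, ho => h.overSig hT ho
  | .appC h _, ho => ⟨h.overSig hT ho.1, hT.level_over _⟩
  | .beta h h', ho => Term.Over.subst (h.overSig hT ho.1) (.inst (h'.overSig hT ho.2))
  | .betaC h _, ho =>
    Term.Over.subst (h.overSig hT ho.1) (.sconsC (.of_renaming id id) (hT.level_over _))
  | .delta h, _ => HasType.overSig (hT.wellTyped.valid h)
  | .tmU _, _ => ⟨hT.declaredIn ty_mem_sig, hT.level_over _⟩
  | .appLam h h', ho => ⟨h.overSig hT ho.1.2.2, h'.overSig hT ho.2⟩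

namespace IsExtension

theorem conv_appC (hT : IsExtension T) (h : T.Conv t t') (hl : T.ConvC l l')
    (ht : t'.OverSig T.sig) : T.Conv (.appC t l) (.appC t' l') :=
  (h.appC_left (hT.level_over l)).trans (.appC_right hl ht hT.level_over)

theorem conv_tm (hT : IsExtension T) (hl : T.ConvC l l') (hA : T.Conv A A')
    (ho : A.OverSig T.sig) : T.Conv (Tm l A) (Tm l' A') :=
  have hTm : (Term.const .Tm).OverSig T.sig := hT.declaredIn tm_mem_sig
  (hT.conv_appC (.refl _) hl hTm).app hA ⟨hTm, hT.level_over _⟩ ho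

theorem conv_tm_u (hT : IsExtension T) (k l : Level) : T.Conv (Tm k (U l)) (Ty l) := by
  refine .of_step ⟨⟨hT.declaredIn tm_mem_sig, hT.level_over _⟩, hT.declaredIn u_mem_sig,
    hT.level_over _⟩ ⟨hT.declaredIn ty_mem_sig, hT.level_over _⟩ (.root (.rule ?_))
  have hmem : ruleU L ∈ T.rules := hT.rules_eq ▸ Set.mem_insert _ _
  exact .mk hmem .var (scons l (scons k .ivar))

theorem conv_app_lam (hT : IsExtension T)
    (ho : (Term.app (.app (applyFamily .App l l' A B) (.app (applyFamily .Lam k k' A' B') t))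
      u).OverSig T.sig) :
    T.Conv (.app (.app (applyFamily .App l l' A B) (.app (applyFamily .Lam k k' A' B') t)) u)
      (.app t u) := by
  refine .of_step ho ⟨ho.1.2.2, ho.2⟩ (.root (.rule ?_))
  have hmem : ruleBeta L ∈ T.rules := hT.rules_eq ▸ Set.mem_insert_of_mem _ rfl
  exact .mk hmem (scons A (scons B (scons A' (scons B' (scons t (scons u .var))))))
    (scons l (scons l' (scons k (scons k' .ivar))))

end IsExtension

theorem Par.conv (hT : IsExtension T) (h : Par T t t') (ho : t.OverSig T.sig) : T.Conv t t' := by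
  induction h with
  | var n => exact .refl _
  | const c => exact .refl _
  | sort s => exact .refl _
  | pi h _ ih ih' => exact (ih ho.1).pi (ih' ho.2) (h.overSig hT ho.1) ho.2
  | piC h _ ih ih' => exact (ih ho.1).piC (ih' ho.2) (h.overSig hT ho.1) ho.2
  | app h _ ih ih' => exact (ih ho.1).app (ih' ho.2) (h.overSig hT ho.1) ho.2
  | abs _ ih => exact (ih ho).abs
  | absC _ ih => exact (ih ho).absC
  | appC h hl ih => exact hT.conv_appC (ih ho.1) hl (h.overSig hT ho.1)
  | beta h h' ih ih' =>
    have ht := h.overSig hT ho.1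
    exact ((ih ho.1).abs.app (ih' ho.2) ht ho.2).trans
      (.of_step ⟨ht, h'.overSig hT ho.2⟩ ((Par.beta h h').overSig hT ho) (.root (.beta _ _)))
  | betaC h hl ih =>
    have ht := h.overSig hT ho.1
    exact (hT.conv_appC (ih ho.1).absC hl ht).trans
      (.of_step ⟨ht, hT.level_over _⟩ ((Par.betaC h hl).overSig hT ho) (.root (.betaC _ _)))
  | delta h => exact .of_step ho ((Par.delta h).overSig hT ho) (.root (.delta h))
  | tmU hl =>
    exact (hT.conv_tm_u _ _).trans (hT.conv_appC (.refl _) hl (hT.declaredIn ty_mem_sig))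
  | appLam h _ ih ih' =>
    exact (hT.conv_app_lam ho).trans
      ((ih ho.1.2.2).app (ih' ho.2) (h.overSig hT ho.1.2.2) ho.2)

theorem conv_of_reflTransGen (hT : IsExtension T) (h : ReflTransGen (Par T) t t')
    (ho : t.OverSig T.sig) : T.Conv t t' := by
  suffices t'.OverSig T.sig ∧ T.Conv t t' from this.2
  induction h with
  | refl => exact ⟨ho, .refl _⟩
  | tail _ h ih => exact ⟨h.overSig hT ih.1, ih.2.trans (h.conv hT ih.1)⟩

theorem conv_of_join (hT : IsExtension T) (h : ReflTransGen (Par T) t t')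
    (h' : ReflTransGen (Par T) u t') (ht : t.OverSig T.sig) (hu : u.OverSig T.sig) :
    T.Conv t u :=
  (conv_of_reflTransGen hT h ht).trans (conv_of_reflTransGen hT h' hu).symm

theorem reflTransGen_pi_inv (h : ReflTransGen (Par T) (.pi A B) t) :
    ∃ A' B', t = .pi A' B' ∧ ReflTransGen (Par T) A A' ∧ ReflTransGen (Par T) B B' := by
  induction h with
  | refl => exact ⟨_, _, rfl, .refl, .refl⟩
  | tail _ h ih =>
    obtain ⟨_, _, rfl, hA, hB⟩ := ih
    cases h with
    | pi h h' => exact ⟨_, _, rfl, hA.tail h, hB.tail h'⟩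

theorem reflTransGen_piC_inv (h : ReflTransGen (Par T) (.piC A B) t) :
    ∃ A' B', t = .piC A' B' ∧ ReflTransGen (Par T) A A' ∧ ReflTransGen (Par T) B B' := by
  induction h with
  | refl => exact ⟨_, _, rfl, .refl, .refl⟩
  | tail _ h ih =>
    obtain ⟨_, _, rfl, hA, hB⟩ := ih
    cases h with
    | piC h h' => exact ⟨_, _, rfl, hA.tail h, hB.tail h'⟩

theorem reflTransGen_tm_pi_inv (hT : IsExtension T)
    (h : ReflTransGen (Par T) (Tm m (Pi l k A B)) t) :
    ∃ m' l' k' A' B', t = Tm m' (Pi l' k' A' B') ∧ T.ConvC l l' ∧ T.ConvC k k' ∧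
      ReflTransGen (Par T) A A' ∧ ReflTransGen (Par T) B B' := by
  induction h with
  | refl => exact ⟨_, _, _, _, _, rfl, .refl _, .refl _, .refl, .refl⟩
  | tail _ h ih =>
    obtain ⟨_, _, _, _, _, rfl, hl, hk, hA, hB⟩ := ih
    unfold Tm Pi at h
    cases h with
    | app h h' =>
      obtain ⟨_, rfl, -⟩ := h.appC_const_inv hT tm_mem_sig
      obtain ⟨_, _, _, _, rfl, hl', hk', hA', hB'⟩ := h'.applyFamily_inv hT pi_mem_sig
      exact ⟨_, _, _, _, _, rfl, hl.trans hl', hk.trans hk', hA.tail hA', hB.tail hB'⟩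

theorem IsExtension.piInjective (hT : IsExtension T) : T.PiInjective where
  pi h ho ho' := by
    obtain ⟨v, hv, hv'⟩ := hT.join_of_conv h
    obtain ⟨_, _, rfl, hA, hB⟩ := reflTransGen_pi_inv hv
    obtain ⟨_, _, ⟨⟩, hA', hB'⟩ := reflTransGen_pi_inv hv'
    exact ⟨conv_of_join hT hA hA' ho.1 ho'.1, conv_of_join hT hB hB' ho.2 ho'.2⟩
  piC h ho ho' := by
    obtain ⟨v, hv, hv'⟩ := hT.join_of_conv h
    obtain ⟨_, _, rfl, hA, hB⟩ := reflTransGen_piC_inv hv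
    obtain ⟨_, _, ⟨⟩, hA', hB'⟩ := reflTransGen_piC_inv hv'
    exact ⟨conv_of_join hT hA hA' ho.1 ho'.1, conv_of_join hT hB hB' ho.2 ho'.2⟩

theorem conv_tm_pi_inj (hT : IsExtension T)
    (h : T.Conv (Tm m (Pi l k A B)) (Tm m' (Pi l' k' A' B')))
    (ho : (Pi l k A B).OverSig T.sig) (ho' : (Pi l' k' A' B').OverSig T.sig) :
    T.ConvC l l' ∧ T.ConvC k k' ∧ T.Conv A A' ∧ T.Conv B B' := by
  obtain ⟨v, hv, hv'⟩ := hT.join_of_conv h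
  obtain ⟨_, _, _, _, _, rfl, hl, hk, hA, hB⟩ := reflTransGen_tm_pi_inv hT hv
  obtain ⟨_, _, _, _, _, ⟨⟩, hl', hk', hA', hB'⟩ := reflTransGen_tm_pi_inv hT hv'
  exact ⟨hl.trans hl'.symm, hk.trans hk'.symm, conv_of_join hT hA hA' ho.1.2 ho'.1.2,
    conv_of_join hT hB hB' ho.2 ho'.2⟩

end Injectivity

/-! ## Preservation of types by the rewrite rules -/

section Rules

variable {Γ : Ctx (Const L) arity} {A B A' B' C D t t' u : Trm L} {l l' k k' : Level} {c : Const L}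

theorem principal_const (hT : IsExtension T) (hc : Decl.const c A ∈ sig L) :
    Principal T Γ (.const c) (A.subst .var .ivar) :=
  A.subst_id.symm ▸ .const hT.wellFormed (hT.sig_subset hc)

theorem principal_applyFamily (hT : IsExtension T)
    (hc : Decl.const c (.piC Lvl <| .piC Lvl <| .pi (Ty (i 1)) <|
      .pi (.pi (Tm (i 1) (x 0)) (Ty (i 0))) C) ∈ sig L) :
    Principal T Γ (applyFamily c l l' A B)
      (C.subst (scons B (scons A .var)) (scons l' (scons l .ivar))) :=
  have hinj := hT.piInjective
  have hwt := hT.wellTyped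
  (((principal_const hT hc).appC hinj hwt).appC hinj hwt).app hinj hwt |>.app hinj hwt

theorem hasType_tm_inv (hT : IsExtension T) (h : HasType T Γ (Tm k A) D) :
    HasType T Γ A (Ty k) ∧ ConvType T Γ type D :=
  (((principal_const hT tm_mem_sig).appC hT.piInjective hT.wellTyped).app_inv hT.piInjective
    hT.wellTyped h).2

theorem hasType_u_inv (hT : IsExtension T) (h : HasType T Γ (U l) D) : HasTypeC T Γ l Lvl :=
  ((principal_const hT u_mem_sig).appC_inv hT.piInjective hT.wellTyped h).2.1

theorem max_subst (l l' : Level) (τ : ℕ → Level) :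
    (max l l').subst τ = max (l.subst τ) (l'.subst τ) := by
  simp only [max, CTerm.subst]
  congr 1
  funext k
  fin_cases k <;> rfl

theorem hasType_lam_inv (hT : IsExtension T)
    (h : HasType T Γ (.app (applyFamily .Lam l l' A B) t) D) :
    HasType T Γ t (.pi (Tm l A) (Tm l' (.app B.shift (.var 0)))) ∧
      ConvType T Γ (Tm (max l l') (Pi l l' A B)) D := by
  obtain ⟨-, ht, hD⟩ :=
    (principal_applyFamily hT lam_mem_sig).app_inv hT.piInjective hT.wellTyped h
  simp only [Tm, Term.subst, max_subst] at hD
  exact ⟨ht, hD⟩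

theorem hasType_app_inv (hT : IsExtension T)
    (h : HasType T Γ (.app (.app (applyFamily .App l l' A B) t) u) D) :
    HasType T Γ t (Tm (max l l') (Pi l l' A B)) ∧ HasType T Γ u (Tm l A) ∧
      IsType T Γ (Tm l' (.app B u)) ∧ ConvType T Γ (Tm l' (.app B u)) D := by
  have hinj := hT.piInjective
  have hwt := hT.wellTyped
  have hp := principal_applyFamily (Γ := Γ) (A := A) (B := B) (l := l) (l' := l') hT app_mem_sig
  obtain ⟨htu, hD⟩ := (hp.app hinj hwt).app hinj hwt _ h
  obtain ⟨ht', hu, -⟩ := (hp.app hinj hwt).app_inv hinj hwt h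
  obtain ⟨-, ht, -⟩ := hp.app_inv hinj hwt ht'
  simp only [Tm, Term.subst, max_subst] at ht
  exact ⟨ht, hu, htu.isType hwt, hD⟩

theorem hasType_ty_of_tm_u (hT : IsExtension T) (h : HasType T Γ (Tm k (U l)) D) :
    HasType T Γ (Ty l) D := by
  obtain ⟨hU, hD⟩ := hasType_tm_inv hT h
  have hTy : HasType T Γ (.const .Ty) (.piC Lvl type) :=
    .const h.wfCtx (hT.sig_subset ty_mem_sig)
  exact hD.hasType (hTy.appC (hasType_u_inv hT hU))

theorem hasType_app_of_pi_tm
    (ht : HasType T Γ t (.pi (Tm l A) (Tm l' (.app B.shift (.var 0)))))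
    (hu : HasType T Γ u (Tm l A)) : HasType T Γ (.app t u) (Tm l' (.app B u)) := by
  have hinst :
      (Tm l' (.app B.shift (.var 0)) : Trm L).inst u = Tm l' (.app (B.shift.inst u) u) := by
    simp only [Tm, Term.inst, Term.subst, CTerm.subst_id, scons]
  have htu := ht.app hu
  rwa [hinst, Term.shift_inst] at htu

theorem hasType_app_of_app_lam (hT : IsExtension T)
    (h : HasType T Γ
      (.app (.app (applyFamily .App l l' A B) (.app (applyFamily .Lam k k' A' B') t)) u) D) :
    HasType T Γ (.app t u) D := by
  have hwt := hT.wellTyped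
  obtain ⟨hlam, hu, hBu, hD⟩ := hasType_app_inv hT h
  obtain ⟨ht, hPi⟩ := hasType_lam_inv hT hlam
  have hoAB := h.overSig.1.1
  have hoAB' := hlam.overSig.1
  have hoPi : (Pi k k' A' B').OverSig T.sig :=
    ⟨⟨⟨⟨hT.declaredIn pi_mem_sig, hT.level_over _⟩, hT.level_over _⟩, hoAB'.1.2⟩, hoAB'.2⟩
  obtain ⟨hl, hl', hA, hB⟩ := conv_tm_pi_inj hT hPi.conv hoPi (hlam.isType hwt).overSig.2
  obtain ⟨_, hTmA, _⟩ := (ht.isType hwt).of_pi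
  have hu' : HasType T Γ u (Tm k A') :=
    .conv hu hTmA (hT.conv_tm hl.symm hA.symm hoAB.1.2)
  have hBu' : T.Conv (Tm k' (.app B' u)) (Tm l' (.app B u)) :=
    hT.conv_tm hl' (hB.app (.refl _) hoAB.2 hu.overSig) ⟨hoAB'.2, hu.overSig⟩
  exact hD.hasType ((hBu.convType hBu' nofun).hasType (hasType_app_of_pi_tm ht hu'))

theorem hasType_of_ruleRoot (hT : IsExtension T) (hs : T.RuleRoot t t') (h : HasType T Γ t D) :
    HasType T Γ t' D := by
  obtain ⟨hr, σ, τ⟩ := hs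
  rw [hT.rules_eq] at hr
  rcases hr with rfl | rfl
  exacts [hasType_ty_of_tm_u hT h, hasType_app_of_app_lam hT h]

end Rules

end UPP

theorem mainTheorem5_general {L : Type*} {T : Dedukti.Theory (UPP.Const L) UPP.arity}
    (hT : UPP.IsExtension T) {Γ : Dedukti.Ctx (UPP.Const L) UPP.arity}
    {t t' A : Dedukti.Term (UPP.Const L) UPP.arity} (ht : Dedukti.HasType T Γ t A)
    (hstep : T.Step t t') : Dedukti.HasType T Γ t' A :=
  ht.step hT.wellFormed hT.piInjective (UPP.hasType_of_ruleRoot hT) hstep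

theorem mainTheorem5 {L : Type*} (Φ : List (Dedukti.Decl (UPP.Const L) UPP.arity))
    (hΦ : (UPP.theory L).IsLocalSignature Φ)
    (Γ : Dedukti.Ctx (UPP.Const L) UPP.arity) (t t' A : Dedukti.Term (UPP.Const L) UPP.arity)
    (ht : Dedukti.HasType ((UPP.theory L).extend Φ) Γ t A)
    (hstep : ((UPP.theory L).extend Φ).Step t t') :
    Dedukti.HasType ((UPP.theory L).extend Φ) Γ t' A :=
  mainTheorem5_general ⟨hΦ.2, List.subset_append_left _ _, rfl⟩ ht hstep
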